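/- Fix integers $N\ge 0$ and $d_{\mathrm{in}}\ge 0$. Consider a multiplicative filter network of hidden width $d_{\mathrm h}$ with sine layers $g_i(x)=\sin(\omega_i x+\phi_i)\in\mathbb R^{d_{\mathrm h}}$ (sine applied entrywise), $0\le i\le N$, and hidden states $$z_0=g_0(x),\qquad a_i=W_i z_{i-1}+b_i,\qquad z_i=g_i(x)\circ a_i\quad(1\le i\le N),$$ where $\circ$ is the Hadamard product. Let all the scalars below be independent random variables: the coordinates of the input $x\in\mathbb R^{d_{\mathrm{in}}}$, uniform on $[-0.5,0.5]$; the entries of the frequencies $\omega_i\in\mathbb R^{d_{\mathrm h}\times d_{\mathrm{in}}}$, uniform on $[-B_i,B_i]$ with $B_i>0$; the entries of the phases $\phi_i\in\mathbb R^{d_{\mathrm h}}$, uniform on $[-\pi,\pi]$; the entries of the weights $W_i\in\mathbb R^{d_{\mathrm h}\times d_{\mathrm h}}$, uniform on $[-\sqrt{6/d_{\mathrm h}},\sqrt{6/d_{\mathrm h}}]$; and the entries of the biases $b_i\in\mathbb R^{d_{\mathrm h}}$, of arbitrary laws with absolute value almost surely at most $\beta$. Take any sequence of such networks, with $N$ and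 $d_{\mathrm{in}}$ fixed, along which $d_{\mathrm h}\to\infty$ and $\beta\to 0$, while the bandwidths $B_i>0$ may vary arbitrarily with the network (in particular they may be large, or tend to infinity), and choose a unit $j\in\{1,\dots,d_{\mathrm h}\}$ in each network. Then: 1. every sine layer output satisfies $\mathbb E[g_i(x)^{(j)}]=0$ and $\operatorname{Var}[g_i(x)^{(j)}]=\tfrac12$, for $0\le i\le N$; 2. the activations after every linear layer are asymptotically standard normal: for $1\le i\le N$, $a_i^{(j)}$ converges in distribution to $\mathcal N(0,1)$; moreover $a_i^{(j)}$ is square integrable, $\mathbb E[a_i^{(j)}]\to 0$ and $\operatorname{Var}[a_i^{(j)}]\to 1$; 3. the Hadamard products satisfy $\mathbb E[z_i^{(j)}]=0$ and $\operatorname{Var}[z_i^{(j)}]\to\tfrac12$, for $1\le i\le N$. -/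

import Mathlib

open MeasureTheory ProbabilityTheory Filter Topology

namespace Bacon

/-- Labels of the real random variables entering a network with `N` linear layers, `N + 1` sine
layers, input dimension `din` and hidden width `d`: the coordinates of the input `x`, the
frequencies `ω_i` and phases `φ_i` of the sine layers, and the weights and biases of the linear
layers. Linear layer `i` maps the hidden state number `i` into the hidden state
number `i + 1`. -/
inductive Coord (N din d : ℕ) : Type
  | input (k : Fin din)
  | freq (i : Fin (N + 1)) (j : Fin d) (k : Fin din)
  | phase (i : Fin (N + 1)) (j : Fin d)
  | weight (i : Fin N) (j k : Fin d)
  | bias (i : Fin N) (j : Fin d)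

section Network

variable {N din d : ℕ}

/-- The sine layer `g_i(x) = sin(ω_i x + φ_i)`. -/
noncomputable def sineLayer (θ : Coord N din d → ℝ) (i : Fin (N + 1)) (j : Fin d) : ℝ :=
  Real.sin (∑ k, θ (.freq i j k) * θ (.input k) + θ (.phase i j))

/-- The affine map `z ↦ W z + b` of linear layer `i`. -/
noncomputable def linearLayer (θ : Coord N din d → ℝ) (i : Fin N) (z : Fin d → ℝ) (j : Fin d) : ℝ :=
  ∑ k, θ (.weight i j k) * z k + θ (.bias i j)

/-- The hidden states: `z_0 = g_0(x)`, and `z_{i+1} = g_{i+1}(x) ∘ (W z_i + b)`, where `∘` is the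
Hadamard product and `W`, `b` belong to linear layer `i`. -/
noncomputable def hidden (θ : Coord N din d → ℝ) (i : Fin (N + 1)) : Fin d → ℝ :=
  Fin.induction (motive := fun _ => Fin d → ℝ) (sineLayer θ 0)
    (fun i z j => sineLayer θ i.succ j * linearLayer θ i z j) i

/-- The activations right after linear layer `i`, that is `W z_i + b`. -/
noncomputable def activation (θ : Coord N din d → ℝ) (i : Fin N) : Fin d → ℝ :=
  linearLayer θ i (hidden θ i.castSucc)

theorem hidden_zero (θ : Coord N din d → ℝ) : hidden θ 0 = sineLayer θ 0 := rfl

theorem hidden_succ (θ : Coord N din d → ℝ) (i : Fin N) (j : Fin d) :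
    hidden θ i.succ j = sineLayer θ i.succ j * activation θ i j := by
  simp [hidden, activation, Fin.induction_succ]

end Network

/-- The random input and the random initialization of the network: all scalars are independent,
inputs are uniform on `[-0.5, 0.5]`, the frequencies of sine layer `i` are uniform on
`[-B i, B i]`, phases are uniform on `[-π, π]`, weights are uniform on `[-√(6/d), √(6/d)]`, and
biases have arbitrary laws, bounded by `β`. -/
structure IsInitialization {N din d : ℕ} {Ω : Type*} [MeasurableSpace Ω]
    (θ : Coord N din d → Ω → ℝ) (P : Measure Ω) (B : Fin (N + 1) → ℝ) (β : ℝ) : Prop where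
  measurable : ∀ c, Measurable (θ c)
  indep : iIndepFun θ P
  input_uniform : ∀ k, pdf.IsUniform (θ (.input k)) (Set.Icc (-0.5) 0.5) P volume
  freq_uniform : ∀ i j k, pdf.IsUniform (θ (.freq i j k)) (Set.Icc (-B i) (B i)) P volume
  phase_uniform : ∀ i j, pdf.IsUniform (θ (.phase i j)) (Set.Icc (-Real.pi) Real.pi) P volume
  weight_uniform : ∀ i j k, pdf.IsUniform (θ (.weight i j k))
    (Set.Icc (-Real.sqrt (6 / (d : ℝ))) (Real.sqrt (6 / (d : ℝ)))) P volume
  bias_le : ∀ i j, ∀ᵐ w ∂P, |θ (.bias i j) w| ≤ β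

end Bacon

/-! A phase uniform over a full period makes the sine output forget its argument: conditionally on
the input and all frequencies, every $\sin(\omega x+\phi)$ has the law of $\sin\phi$, with mean $0$
and second moment $1/2$. This conditional law is constant, so the sine outputs of all units and
layers are jointly independent, and independent of weights and biases, although they share the input
(`iIndepFun_skew`, `IsInitialization.isSineFamily`). Input and frequencies then drop out, and with
them the bandwidths.

What remains is $z_{i+1}=s_{i+1}\circ(W_iz_i+b_i)$ with independent ingredients. Let $Q_i$ be the
mean of the squared coordinates of $z_i$. Given $z_i$, the activation is a sum of independent
centered terms of total variance $2Q_i$, plus a small bias, since each weight has variance $2/d$.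
Its characteristic function is within $O(t^4 d^{-1}\cdot\text{mean of }z_k^4)+|t|\beta$ of
$e^{-t^2Q_i}$ (`norm_integral_exp_linearLayer_sub_le`).

It remains to see that $Q_i\to 1/2$ in $L^2$. Given $z_i$, the units of the next layer are
independent and their squares have mean $Q_i+\mathbb E[b^2]/2$, so $Q_{i+1}-Q_i$ is small in $L^2$
(`integral_meanPow_product_sub_sq_le`); the initial $Q_0$ is an average of independent squared
sines. Induction over the fixed number of layers gives the concentration, and fourth moments stay
bounded. Lévy's continuity theorem and the exact moment identities conclude. -/

namespace Bacon

/-! ### Independence of coordinate blocks, resampling, and skew transformations. -/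

section Independence

variable {ι Ω : Type*} [MeasurableSpace Ω] {P : Measure Ω} {η : ι → Ω → ℝ}

/-- The vector that agrees with `u` on `S` and vanishes elsewhere. -/
noncomputable def extendZero (S : Finset ι) (u : S → ℝ) : ι → ℝ :=
  open Classical in fun c => if h : c ∈ S then u ⟨c, h⟩ else 0

theorem measurable_extendZero (S : Finset ι) : Measurable (extendZero S) := by
  classical
  refine measurable_pi_lambda _ fun c => ?_
  unfold extendZero
  by_cases h : c ∈ S
  · simpa [h] using measurable_pi_apply (⟨c, h⟩ : S)
  · simp [h]

theorem _root_.DependsOn.extendZero_eq {α : Type*} {S : Finset ι} {f : (ι → ℝ) → α}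
    (hf : DependsOn f (S : Set ι)) (x : ι → ℝ) : f (extendZero S fun c => x c) = f x :=
  hf fun c hc => by simp [extendZero, Finset.mem_coe.1 hc]

theorem indepFun_of_dependsOn [Finite ι] (hη : iIndepFun η P) (hm : ∀ c, Measurable (η c))
    {α α' : Type*} [MeasurableSpace α] [MeasurableSpace α']
    {f : (ι → ℝ) → α} {g : (ι → ℝ) → α'} (hf : Measurable f) (hg : Measurable g)
    {S T : Set ι} (hfS : DependsOn f S) (hgT : DependsOn g T) (hST : Disjoint S T) :
    IndepFun (fun w => f fun c => η c w) (fun w => g fun c => η c w) P := by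
  lift S to Finset ι using S.toFinite
  lift T to Finset ι using T.toFinite
  rw [Finset.disjoint_coe] at hST
  have h := (hη.indepFun_finset S T hST hm).comp
    (hf.comp (measurable_extendZero S)) (hg.comp (measurable_extendZero T))
  have e1 : (f ∘ extendZero S) ∘ (fun w (i : S) => η i w) = fun w => f fun c => η c w :=
    funext fun w => hfS.extendZero_eq fun c => η c w
  have e2 : (g ∘ extendZero T) ∘ (fun w (i : T) => η i w) = fun w => g fun c => η c w :=
    funext fun w => hgT.extendZero_eq fun c => η c w
  rwa [e1, e2] at h

/-- Fubini: a group of independent coordinates may be resampled independently of the others. -/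
theorem integral_of_dependsOn [Finite ι] [IsProbabilityMeasure P]
    {E : Type*} [NormedAddCommGroup E] [NormedSpace ℝ E]
    (hη : iIndepFun η P) (hm : ∀ c, Measurable (η c))
    {α : Type*} [MeasurableSpace α] {f : (ι → ℝ) → α} (hf : Measurable f)
    {G : α → (ι → ℝ) → E} (hG : StronglyMeasurable (Function.uncurry G))
    {S T : Set ι} (hfS : DependsOn f S) (hGT : ∀ z, DependsOn (G z) T)
    (hST : Disjoint S T) (hint : Integrable (fun w => G (f fun c => η c w) fun c => η c w) P) :
    ∫ w, G (f fun c => η c w) (fun c => η c w) ∂P =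
      ∫ w, ∫ w', G (f fun c => η c w) (fun c => η c w') ∂P ∂P := by
  lift T to Finset ι using T.toFinite
  let X : Ω → α := fun w => f fun c => η c w
  let Y : Ω → ι → ℝ := fun w => extendZero T fun c : T => η c w
  have hX : Measurable X := hf.comp (measurable_pi_lambda _ hm)
  have hY : Measurable Y :=
    (measurable_extendZero T).comp (measurable_pi_lambda _ fun c => hm c)
  have hXY : IndepFun X Y P :=
    indepFun_of_dependsOn hη hm hf
      (g := fun x => extendZero T fun c : T => x c)
      ((measurable_extendZero T).comp (measurable_pi_lambda _ fun c => measurable_pi_apply _))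
      hfS (fun x y h => congrArg _ (funext fun c : T => h c c.2)) hST
  have e (z : α) (w : Ω) : G z (fun c => η c w) = G z (Y w) :=
    ((hGT z).extendZero_eq fun c => η c w).symm
  have hlaw := hXY.map_prod_eq_prod_map_map hX.aemeasurable hY.aemeasurable
  simp only [e] at hint ⊢
  have hint' : Integrable (Function.uncurry G) ((P.map X).prod (P.map Y)) := by
    rw [← hlaw, integrable_map_measure hG.aestronglyMeasurable (by fun_prop)]
    exact hint
  have := Measure.isProbabilityMeasure_map (μ := P) hX.aemeasurable
  have := Measure.isProbabilityMeasure_map (μ := P) hY.aemeasurable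
  calc ∫ w, G (X w) (Y w) ∂P
      = ∫ p, Function.uncurry G p ∂(P.map fun w => (X w, Y w)) := by
        rw [integral_map (by fun_prop) hG.aestronglyMeasurable]; rfl
    _ = ∫ x, ∫ y, G x y ∂(P.map Y) ∂(P.map X) := by
        rw [hlaw, integral_prod _ hint']; rfl
    _ = ∫ w, ∫ y, G (X w) y ∂(P.map Y) ∂P := by
        rw [integral_map hX.aemeasurable]
        exact (hG.integral_prod_right (ν := P.map Y)).aestronglyMeasurable
    _ = _ := by
        refine integral_congr_ae (ae_of_all _ fun w => ?_)
        exact integral_map hY.aemeasurable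
          (hG.comp_measurable (measurable_prodMk_left)).aestronglyMeasurable

/-- Transforming independent coordinates by maps that depend on a group `A` of coordinates keeps
them independent, as long as the laws of the images do not depend on the coordinates in `A`. -/
theorem measureReal_iInter_skew [Finite ι] [IsProbabilityMeasure P]
    (hη : iIndepFun η P) (hm : ∀ c, Measurable (η c)) (A T : Finset ι) (hAT : Disjoint A T)
    {f : ι → (ι → ℝ) → ℝ → ℝ} (hf : ∀ c, Measurable (Function.uncurry (f c)))
    (hfA : ∀ c x, DependsOn (fun u => f c u x) (A : Set ι))
    (hfc : ∀ c ∉ T, ∀ u x y, f c u x = f c u y)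
    {ν : ι → Measure ℝ} (hν : ∀ c u, P.map (fun w => f c u (η c w)) = ν c)
    (S : Finset ι) {s : ι → Set ℝ} (hs : ∀ c, MeasurableSet (s c)) :
    P.real (⋂ c ∈ S, (fun w => f c (fun c' => η c' w) (η c w)) ⁻¹' s c) =
      ∏ c ∈ S, (ν c).real (s c) := by
  classical
  -- `r` keeps only the `A`-coordinates, so the first argument of `G` is frozen while the
  -- `T`-coordinates are resampled.
  let r : (ι → ℝ) → (ι → ℝ) := fun x => extendZero A fun c : A => x c
  have hr : Measurable r :=
    (measurable_extendZero A).comp (measurable_pi_lambda _ fun c => measurable_pi_apply _)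
  have hrA : DependsOn r (A : Set ι) := fun x y h =>
    congrArg (extendZero A) (funext fun c : A => h c c.2)
  have hfr (c u x) : f c (r u) x = f c u x := (hfA c x).extendZero_eq u
  let G : (ι → ℝ) → (ι → ℝ) → ℝ := fun z v =>
    ∏ c ∈ S, (s c).indicator (fun _ => (1 : ℝ)) (f c z (v c))
  have hGm : Measurable (Function.uncurry G) := by
    refine Finset.measurable_prod _ fun c _ => ?_
    refine (measurable_const.indicator (hs c)).comp ?_
    exact (hf c).comp (measurable_fst.prodMk ((measurable_pi_apply c).comp measurable_snd))
  have hηm : Measurable fun w => (fun c => η c w) := measurable_pi_lambda _ hm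
  have hG1 (z v) : ‖G z v‖ ≤ 1 := by
    rw [norm_prod]
    refine Finset.prod_le_one (fun _ _ => norm_nonneg _) fun c _ => ?_
    by_cases h : f c z (v c) ∈ s c <;> simp [h]
  have hfcm (c u) : Measurable fun w => f c u (η c w) :=
    (hf c).comp (measurable_const.prodMk (hm c))
  have hset : MeasurableSet (⋂ c ∈ S, (fun w => f c (fun c' => η c' w) (η c w)) ⁻¹' s c) :=
    Finset.measurableSet_biInter _ fun c _ =>
      (hf c).comp (hηm.prodMk (hm c)) (hs c)
  calc _ = ∫ w, G (r fun c => η c w) (fun c => η c w) ∂P := by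
        rw [← integral_indicator_one hset]
        refine integral_congr_ae (ae_of_all _ fun w => ?_)
        simp only [G, hfr, Set.indicator_apply, Set.mem_iInter, Set.mem_preimage, Pi.one_apply]
        rw [Finset.prod_ite_zero]
        simp
    _ = ∫ w, ∫ w', G (r fun c => η c w) (fun c => η c w') ∂P ∂P := by
        refine integral_of_dependsOn hη hm hr hGm.stronglyMeasurable hrA (T := T) ?_
          (Finset.disjoint_coe.2 hAT) ?_
        · intro z x y h
          refine Finset.prod_congr rfl fun c _ => ?_
          by_cases hc : c ∈ T
          · simp only [h c hc]
          · rw [hfc c hc z (x c) (y c)]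
        · refine Integrable.of_bound (C := 1) ?_ (ae_of_all _ fun w => hG1 _ _)
          exact (hGm.comp ((hr.comp hηm).prodMk hηm)).aestronglyMeasurable
    _ = ∫ w, ∏ c ∈ S, (ν c).real (s c) ∂P := by
        refine integral_congr_ae (ae_of_all _ fun w => ?_)
        simp only [G]
        -- With the `A`-coordinates frozen, each factor is a function of a single coordinate, and
        -- its law `ν c` no longer depends on the frozen value.
        have hi : iIndepFun (fun c w' => (s c).indicator (fun _ => (1 : ℝ))
            (f c (r fun c => η c w) (η c w'))) P :=
          hη.comp (fun c x => (s c).indicator (fun _ => (1 : ℝ)) (f c (r fun c => η c w) x))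
            fun c => (measurable_const.indicator (hs c)).comp
              ((hf c).comp (measurable_const.prodMk measurable_id))
        have hi' := hi.precomp (g := ((↑) : S → ι)) Subtype.val_injective
        have := hi'.integral_fun_prod_eq_prod_integral fun c =>
          ((measurable_const.indicator (hs c)).comp (hfcm c _)).aestronglyMeasurable
        simp only [← Finset.prod_coe_sort S]
        refine this.trans (Finset.prod_congr rfl fun c _ => ?_)
        rw [← hν c (r fun c => η c w), map_measureReal_apply (hfcm _ _) (hs c),
          ← integral_indicator_one (hfcm _ _ (hs c))]
        rfl
    _ = _ := by simp

/-- The product formula for finite intersections carries both claims: a single index identifies the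
laws, and several indices then give independence. -/
theorem iIndepFun_skew [Finite ι] [IsProbabilityMeasure P]
    (hη : iIndepFun η P) (hm : ∀ c, Measurable (η c)) (A T : Finset ι) (hAT : Disjoint A T)
    {f : ι → (ι → ℝ) → ℝ → ℝ} (hf : ∀ c, Measurable (Function.uncurry (f c)))
    (hfA : ∀ c x, DependsOn (fun u => f c u x) (A : Set ι))
    (hfc : ∀ c ∉ T, ∀ u x y, f c u x = f c u y)
    {ν : ι → Measure ℝ} (hν : ∀ c u, P.map (fun w => f c u (η c w)) = ν c) :
    iIndepFun (fun c w => f c (fun c' => η c' w) (η c w)) P ∧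
      ∀ c, P.map (fun w => f c (fun c' => η c' w) (η c w)) = ν c := by
  have hfm (c) : Measurable fun w => f c (fun c' => η c' w) (η c w) :=
    (hf c).comp ((measurable_pi_lambda _ hm).prodMk (hm c))
  have hνp (c) : IsProbabilityMeasure (ν c) := by
    rw [← hν c 0]
    exact Measure.isProbabilityMeasure_map
      ((hf c).comp (measurable_const.prodMk (hm c))).aemeasurable
  have key := measureReal_iInter_skew hη hm A T hAT hf hfA hfc hν
  have hlaw (c) : P.map (fun w => f c (fun c' => η c' w) (η c w)) = ν c := by
    have := Measure.isProbabilityMeasure_map (μ := P) (hfm c).aemeasurable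
    refine Measure.ext fun s hs => ?_
    have h := key {c} (s := fun _ => s) fun _ => hs
    simp only [Finset.mem_singleton, Set.iInter_iInter_eq_left, Finset.prod_singleton] at h
    rw [← measureReal_eq_measureReal_iff, ← h, map_measureReal_apply (hfm c) hs]
  refine ⟨?_, hlaw⟩
  classical
  rw [iIndepFun_iff_measure_inter_preimage_eq_mul]
  intro S sets hsets
  -- The product formula asks for measurability at every index, so the sets outside `S` are replaced
  -- by the whole line.
  have h := key S (s := fun c => if c ∈ S then sets c else Set.univ) fun c => by
    by_cases h : c ∈ S <;> simp [h, hsets]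
  rw [← ENNReal.toReal_eq_toReal_iff' (measure_ne_top _ _)
    (ENNReal.prod_ne_top fun _ _ => measure_ne_top _ _), ENNReal.toReal_prod]
  have e : (⋂ c ∈ S, (fun w => f c (fun c' => η c' w) (η c w)) ⁻¹' sets c) =
      ⋂ c ∈ S, (fun w => f c (fun c' => η c' w) (η c w)) ⁻¹'
        (if c ∈ S then sets c else Set.univ) :=
    Set.iInter₂_congr fun c hc => by rw [if_pos hc]
  rw [e]
  refine h.trans (Finset.prod_congr rfl fun c hc => ?_)
  rw [if_pos hc, ← hlaw c, map_measureReal_apply (hfm c) (hsets c hc)]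
  rfl

end Independence


/-! ### Integrals against symmetric uniform laws. -/

section Uniform

variable {Ω : Type*} [MeasurableSpace Ω] {P : Measure Ω} {X : Ω → ℝ} {r : ℝ}

theorem integral_comp_of_isUniform (hr : 0 < r) (hX : Measurable X)
    (hu : pdf.IsUniform X (Set.Icc (-r) r) P volume)
    {E : Type*} [NormedAddCommGroup E] [NormedSpace ℝ E]
    {f : ℝ → E} (hf : StronglyMeasurable f) :
    ∫ w, f (X w) ∂P = (2 * r)⁻¹ • ∫ x in -r..r, f x := by
  rw [← integral_map hX.aemeasurable hf.aestronglyMeasurable, show P.map X = _ from hu,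
    ProbabilityTheory.cond, integral_smul_measure, Real.volume_Icc, ENNReal.toReal_inv,
    ENNReal.toReal_ofReal (by linarith), intervalIntegral.integral_of_le (by linarith),
    integral_Icc_eq_integral_Ioc]
  ring_nf

theorem ae_abs_le_of_isUniform (hX : Measurable X)
    (hu : pdf.IsUniform X (Set.Icc (-r) r) P volume) : ∀ᵐ w ∂P, |X w| ≤ r := by
  have h : ∀ᵐ x ∂(P.map X), x ∈ Set.Icc (-r) r := by
    rw [show P.map X = _ from hu]
    exact ae_cond_mem measurableSet_Icc
  filter_upwards [ae_of_ae_map hX.aemeasurable h] with w hw using abs_le.2 hw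

theorem integral_odd_of_isUniform (hr : 0 < r) (hX : Measurable X)
    (hu : pdf.IsUniform X (Set.Icc (-r) r) P volume) {f : ℝ → ℝ} (hf : Measurable f)
    (ho : ∀ x, f (-x) = -f x) : ∫ w, f (X w) ∂P = 0 := by
  rw [integral_comp_of_isUniform hr hX hu hf.stronglyMeasurable,
    smul_eq_mul, mul_eq_zero]
  right
  have h := intervalIntegral.integral_comp_neg f (a := -r) (b := r)
  simp only [ho, intervalIntegral.integral_neg, neg_neg] at h
  linarith

theorem integral_sq_of_isUniform (hr : 0 < r) (hX : Measurable X)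
    (hu : pdf.IsUniform X (Set.Icc (-r) r) P volume) : ∫ w, X w ^ 2 ∂P = r ^ 2 / 3 := by
  rw [integral_comp_of_isUniform hr hX hu (f := fun x => x ^ 2) (by fun_prop), integral_pow,
    smul_eq_mul]
  field_simp
  ring

/-- The interval of the phase is one full period of the sine, and the integral of a periodic
function over a period is unchanged by translation. -/
theorem map_sin_add_of_isUniform [IsFiniteMeasure P] (hX : Measurable X)
    (hu : pdf.IsUniform X (Set.Icc (-Real.pi) Real.pi) P volume) (t : ℝ) :
    P.map (fun w => Real.sin (t + X w)) = P.map (fun w => Real.sin (X w)) := by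
  have hm (t : ℝ) : Measurable fun w => Real.sin (t + X w) := by fun_prop
  have key (t : ℝ) (s : Set ℝ) (hs : MeasurableSet s) :
      (P.map (fun w => Real.sin (t + X w))).real s =
        (2 * Real.pi)⁻¹ • ∫ x in -Real.pi..Real.pi,
          s.indicator (fun _ => (1 : ℝ)) (Real.sin x) := by
    have hi : Measurable (s.indicator fun _ => (1 : ℝ)) := measurable_const.indicator hs
    rw [map_measureReal_apply (hm t) hs, ← integral_indicator_one (hm t hs)]
    refine (integral_comp_of_isUniform Real.pi_pos hX hu
      (f := fun x => s.indicator (fun _ => (1 : ℝ)) (Real.sin (t + x)))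
      (hi.comp (by fun_prop)).stronglyMeasurable).trans ?_
    congr 1
    have hp : Function.Periodic (fun x => s.indicator (fun _ => (1 : ℝ)) (Real.sin x))
        (2 * Real.pi) := fun x => by simp only [Real.sin_add_two_pi]
    have h := hp.intervalIntegral_add_eq (t + -Real.pi) (-Real.pi)
    rw [intervalIntegral.integral_comp_add_left
      (fun x => s.indicator (fun _ => (1 : ℝ)) (Real.sin x))]
    convert h using 2 <;> ring
  refine Measure.ext fun s hs => ?_
  have h0 := key 0 s hs
  simp only [zero_add] at h0
  rw [← measureReal_eq_measureReal_iff, key t s hs, h0]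

end Uniform

/-! ### Reduction to independent sine outputs. -/

/-- `Coord` is a finite type. -/
noncomputable instance (N din d : ℕ) : Fintype (Coord N din d) :=
  Fintype.ofInjective
    (β := Fin din ⊕ (Fin (N + 1) × Fin d × Fin din) ⊕ (Fin (N + 1) × Fin d) ⊕
      (Fin N × Fin d × Fin d) ⊕ (Fin N × Fin d))
    (fun
      | .input k => .inl k
      | .freq i j k => .inr (.inl (i, j, k))
      | .phase i j => .inr (.inr (.inl (i, j)))
      | .weight i j k => .inr (.inr (.inr (.inl (i, j, k))))
      | .bias i j => .inr (.inr (.inr (.inr (i, j)))))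
    (by rintro (_ | _ | _ | _ | _) (_ | _ | _ | _ | _) h <;> simp_all)

/-- The properties of the family obtained from a random initialization by replacing each phase
with the output of the corresponding sine unit, and forgetting the input and the frequencies. -/
structure IsSineFamily {N din d : ℕ} {Ω : Type*} [MeasurableSpace Ω]
    (η : Coord N din d → Ω → ℝ) (P : Measure Ω) (β : ℝ) : Prop where
  measurable : ∀ c, Measurable (η c)
  indep : iIndepFun η P
  phase_le : ∀ i j, ∀ᵐ w ∂P, |η (.phase i j) w| ≤ 1
  phase_mean : ∀ i j, ∫ w, η (.phase i j) w ∂P = 0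
  phase_sq : ∀ i j, ∫ w, η (.phase i j) w ^ 2 ∂P = 1 / 2
  weight_le : ∀ i j k, ∀ᵐ w ∂P, |η (.weight i j k) w| ≤ √(6 / (d : ℝ))
  weight_mean : ∀ i j k, ∫ w, η (.weight i j k) w ∂P = 0
  weight_sq : ∀ i j k, ∫ w, η (.weight i j k) w ^ 2 ∂P = 2 / d
  weight_sin : ∀ i j k (t : ℝ), ∫ w, Real.sin (t * η (.weight i j k) w) ∂P = 0
  bias_le : ∀ i j, ∀ᵐ w ∂P, |η (.bias i j) w| ≤ β

/-- The family in which each phase is replaced with the output of its sine unit. -/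
noncomputable def sineFamily {N din d : ℕ} (θ : Coord N din d → ℝ) : Coord N din d → ℝ
  | .input _ => 0
  | .freq _ _ _ => 0
  | .phase i j => sineLayer θ i j
  | .weight i j k => θ (.weight i j k)
  | .bias i j => θ (.bias i j)

/-- The skew transformation shifts each phase by a function of inputs and frequencies before
applying the sine. The shift does not change the law, so the shared input creates no dependence. -/
theorem IsInitialization.isSineFamily {N din d : ℕ} {Ω : Type*} [MeasurableSpace Ω]
    {P : Measure Ω} [IsProbabilityMeasure P] {θ : Coord N din d → Ω → ℝ}
    {B : Fin (N + 1) → ℝ} {β : ℝ} (hθ : IsInitialization θ P B β) (hd : 0 < d) :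
    IsSineFamily (fun c w => sineFamily (fun c' => θ c' w) c) P β := by
  classical
  let f : Coord N din d → (Coord N din d → ℝ) → ℝ → ℝ := fun c u x =>
    match c with
    | .input _ => 0
    | .freq _ _ _ => 0
    | .phase i j => Real.sin (∑ k, u (.freq i j k) * u (.input k) + x)
    | .weight _ _ _ => x
    | .bias _ _ => x
  -- The frozen block `Tᶜ` consists of the inputs and frequencies, whose own images under `f` are
  -- the constant `0`.
  let T : Finset (Coord N din d) := Finset.univ.filter fun c =>
    match c with
    | .input _ => False
    | .freq _ _ _ => False
    | _ => True
  have hd' : (0 : ℝ) < d := by exact_mod_cast hd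
  have hr : 0 < √(6 / (d : ℝ)) := by positivity
  obtain ⟨h1, h2⟩ := iIndepFun_skew hθ.indep hθ.measurable Tᶜ T disjoint_compl_left (f := f)
    -- The reference law takes all frozen coordinates zero: for a phase it is the law of $\sin\phi$.
    (ν := fun c => P.map fun w => f c 0 (θ c w))
    (by
      rintro (_ | _ | _ | _ | _)
      · exact measurable_const
      · exact measurable_const
      · exact (Real.measurable_sin.comp (by fun_prop))
      · exact measurable_snd
      · exact measurable_snd)
    (by
      rintro (_ | _ | _ | _ | _) x u v h
      · rfl
      · rfl
      · simp only [f]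
        congr 2
        refine Finset.sum_congr rfl fun k _ => ?_
        rw [h _ (by simp [T]), h _ (by simp [T])]
      · rfl
      · rfl)
    (by
      rintro (_ | _ | _ | _ | _) h u x y
      · rfl
      · rfl
      all_goals exact absurd (by simp [T]) h)
    (by
      rintro (_ | _ | ⟨i, j⟩ | _ | _) u
      · rfl
      · rfl
      · simp only [f]
        rw [map_sin_add_of_isUniform (hθ.measurable _) (hθ.phase_uniform i j)]
        simp
      · rfl
      · rfl)
  have e : (fun c w => f c (fun c' => θ c' w) (θ c w)) =
      fun c w => sineFamily (fun c' => θ c' w) c := by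
    funext c w
    cases c <;> rfl
  have hm (c) : Measurable fun w => sineFamily (fun c' => θ c' w) c := by
    have := hθ.measurable
    cases c <;> simp only [sineFamily, sineLayer] <;> fun_prop
  have hph (i : Fin (N + 1)) (j : Fin d) (g : ℝ → ℝ) (hg : Measurable g) :
      ∫ w, g (sineLayer (fun c' => θ c' w) i j) ∂P = ∫ w, g (Real.sin (θ (.phase i j) w)) ∂P := by
    have h := h2 (.phase i j)
    simp only [f, Pi.zero_apply, mul_zero, Finset.sum_const_zero, zero_add] at h
    have h0 := integral_map (μ := P) (f := g) (φ := fun w => sineLayer (fun c' => θ c' w) i j)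
      (hm (.phase i j)).aemeasurable hg.aestronglyMeasurable
    have h' := integral_map (μ := P) (f := g) (φ := fun w => Real.sin (θ (.phase i j) w))
      (Real.measurable_sin.comp (hθ.measurable _)).aemeasurable hg.aestronglyMeasurable
    rw [← h', ← h0, ← h]
    rfl
  exact
    { measurable := hm
      indep := e ▸ h1
      phase_le := fun i j => ae_of_all _ fun w => Real.abs_sin_le_one _
      phase_mean := fun i j => (hph i j id measurable_id).trans <|
        integral_odd_of_isUniform Real.pi_pos (hθ.measurable _) (hθ.phase_uniform i j)
          Real.measurable_sin Real.sin_neg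
      phase_sq := fun i j => by
        refine (hph i j (fun x => x ^ 2) (by fun_prop)).trans ?_
        rw [integral_comp_of_isUniform Real.pi_pos (hθ.measurable _) (hθ.phase_uniform i j)
          (f := fun x => Real.sin x ^ 2) (by fun_prop), integral_sin_sq]
        simp
        field_simp
      weight_le := fun i j k =>
        ae_abs_le_of_isUniform (hθ.measurable _) (hθ.weight_uniform i j k)
      weight_mean := fun i j k =>
        integral_odd_of_isUniform hr (hθ.measurable _) (hθ.weight_uniform i j k)
          measurable_id fun _ => rfl
      weight_sq := fun i j k => by
        refine (integral_sq_of_isUniform hr (hθ.measurable _) (hθ.weight_uniform i j k)).trans ?_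
        rw [Real.sq_sqrt (by positivity)]
        ring
      weight_sin := fun i j k t =>
        integral_odd_of_isUniform hr (hθ.measurable _) (hθ.weight_uniform i j k)
          (f := fun x => Real.sin (t * x)) (by fun_prop) fun x => by
            rw [mul_neg, Real.sin_neg]
      bias_le := hθ.bias_le }


/-! ### Second and fourth moments of sums of bounded independent variables. -/

section Bounded

variable {Ω : Type*} [MeasurableSpace Ω] {P : Measure Ω} {X Y : Ω → ℝ}

theorem memLp_top_mul (hX : MemLp X ⊤ P) (hY : MemLp Y ⊤ P) :
    MemLp (fun w => X w * Y w) ⊤ P := MemLp.mul' (p := ⊤) (q := ⊤) hY hX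

theorem memLp_top_pow [IsFiniteMeasure P] (hX : MemLp X ⊤ P) (n : ℕ) :
    MemLp (fun w => X w ^ n) ⊤ P := by
  induction n with
  | zero => simpa using memLp_const (1 : ℝ)
  | succ n ih => simpa only [pow_succ] using memLp_top_mul ih hX

theorem memLp_top_of_abs_le (hX : Measurable X) {C : ℝ} (h : ∀ᵐ w ∂P, |X w| ≤ C) :
    MemLp X ⊤ P := memLp_top_of_bound hX.aestronglyMeasurable C h

theorem _root_.MeasureTheory.MemLp.integrable_of_top [IsFiniteMeasure P] (hX : MemLp X ⊤ P) :
    Integrable X P := hX.integrable le_top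

/-- Centering one summand already kills the cross term, so the other may be a bias with nonzero
mean. -/
theorem integral_add_sq_of_indepFun [IsProbabilityMeasure P] (hX : MemLp X ⊤ P)
    (hY : MemLp Y ⊤ P) (h : IndepFun X Y P) (hX0 : ∫ w, X w ∂P = 0) :
    ∫ w, (X w + Y w) ^ 2 ∂P = ∫ w, X w ^ 2 ∂P + ∫ w, Y w ^ 2 ∂P := by
  have h1 : ∫ w, X w * Y w ∂P = 0 := by
    rw [h.integral_fun_mul_eq_mul_integral hX.1 hY.1, hX0, zero_mul]
  have e (w) : (X w + Y w) ^ 2 = X w ^ 2 + 2 * (X w * Y w) + Y w ^ 2 := by ring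
  simp only [e]
  have i1 := (memLp_top_pow hX 2).integrable_of_top
  have i2 := (memLp_top_pow hY 2).integrable_of_top
  have i3 := ((memLp_top_mul hX hY).const_mul 2).integrable_of_top
  rw [integral_add (i1.fun_add i3) i2, integral_add i1 i3, integral_const_mul, h1]
  ring

/-- The terms $X^3Y$ and $XY^3$ each contain a centered factor to the first power; only $6X^2Y^2$
survives. -/
theorem integral_add_pow_four_of_indepFun [IsProbabilityMeasure P] (hX : MemLp X ⊤ P)
    (hY : MemLp Y ⊤ P) (h : IndepFun X Y P) (hX0 : ∫ w, X w ∂P = 0) (hY0 : ∫ w, Y w ∂P = 0) :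
    ∫ w, (X w + Y w) ^ 4 ∂P =
      ∫ w, X w ^ 4 ∂P + 6 * (∫ w, X w ^ 2 ∂P) * (∫ w, Y w ^ 2 ∂P) + ∫ w, Y w ^ 4 ∂P := by
  have hp (m n : ℕ) : ∫ w, X w ^ m * Y w ^ n ∂P = (∫ w, X w ^ m ∂P) * ∫ w, Y w ^ n ∂P :=
    (h.comp (measurable_id.pow_const m) (measurable_id.pow_const n)).integral_fun_mul_eq_mul_integral
      (memLp_top_pow hX m).1 (memLp_top_pow hY n).1
  have hi (m n : ℕ) : Integrable (fun w => X w ^ m * Y w ^ n) P :=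
    (memLp_top_mul (memLp_top_pow hX m) (memLp_top_pow hY n)).integrable_of_top
  have e (w) : (X w + Y w) ^ 4 = X w ^ 4 * Y w ^ 0 + 4 * (X w ^ 3 * Y w ^ 1)
      + 6 * (X w ^ 2 * Y w ^ 2) + 4 * (X w ^ 1 * Y w ^ 3) + X w ^ 0 * Y w ^ 4 := by ring
  simp only [e]
  have i1 := hi 4 0
  have i2 := (hi 3 1).const_mul 4
  have i3 := (hi 2 2).const_mul 6
  have i4 := (hi 1 3).const_mul 4
  rw [integral_add (((i1.fun_add i2).fun_add i3).fun_add i4) (hi 0 4), integral_add ((i1.fun_add i2).fun_add i3) i4,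
    integral_add (i1.fun_add i2) i3, integral_add i1 i2]
  simp only [integral_const_mul, hp]
  simp only [pow_one, hX0, hY0, pow_zero, integral_const, probReal_univ,
    smul_eq_mul]
  ring

/-- Moments of a sum of independent centered random variables whose kurtosis is at most `3`. -/
theorem moments_sum_of_iIndepFun [IsProbabilityMeasure P] {κ : Type*} {X : κ → Ω → ℝ}
    (hi : iIndepFun X P) (hm : ∀ k, Measurable (X k)) (hX : ∀ k, MemLp (X k) ⊤ P)
    (h1 : ∀ k, ∫ w, X k w ∂P = 0) {v : κ → ℝ} (h2 : ∀ k, ∫ w, X k w ^ 2 ∂P = v k)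
    (h4 : ∀ k, ∫ w, X k w ^ 4 ∂P ≤ 3 * v k ^ 2) (s : Finset κ) :
    ∫ w, ∑ k ∈ s, X k w ∂P = 0 ∧ ∫ w, (∑ k ∈ s, X k w) ^ 2 ∂P = ∑ k ∈ s, v k ∧
      ∫ w, (∑ k ∈ s, X k w) ^ 4 ∂P ≤ 3 * (∑ k ∈ s, v k) ^ 2 := by
  classical
  induction s using Finset.induction_on with
  | empty => simp
  | insert a s ha ih =>
    obtain ⟨ih1, ih2, ih4⟩ := ih
    have hs : MemLp (fun w => ∑ k ∈ s, X k w) ⊤ P := memLp_finsetSum s fun k _ => hX k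
    have hind : IndepFun (X a) (fun w => ∑ k ∈ s, X k w) P := by
      have := (hi.indepFun_finsetSum_of_notMem hm ha).symm
      convert this using 1
      ext w
      simp
    simp only [Finset.sum_insert ha]
    refine ⟨?_, ?_, ?_⟩
    · rw [integral_add (hX a).integrable_of_top hs.integrable_of_top, h1, ih1, add_zero]
    · rw [integral_add_sq_of_indepFun (hX a) hs hind (h1 a), h2, ih2]
    · rw [integral_add_pow_four_of_indepFun (hX a) hs hind (h1 a) ih1, h2, ih2]
      -- The bound is stable under sums because $3v^2+6vu+3u^2=3(v+u)^2$.
      nlinarith [h4 a]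

end Bounded

/-! ### Elementary inequalities for characteristic functions. -/

section Analysis

/-- Taylor's bound covers $|x|\le 1$; beyond that the difference is at most $x^2/2\le x^4$. The
constant is not sharp, but the bound is global. -/
theorem abs_cos_sub_le (x : ℝ) : |Real.cos x - (1 - x ^ 2 / 2)| ≤ 3 * x ^ 4 := by
  have h0 := Real.one_sub_sq_div_two_le_cos (x := x)
  rw [abs_of_nonneg (by linarith)]
  by_cases hx : |x| ≤ 1
  · have h := Real.cos_bound hx
    have e : |x| ^ 4 = x ^ 4 := by rw [← abs_pow, abs_of_nonneg (by positivity)]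
    rw [e] at h
    have := (le_abs_self _).trans h
    nlinarith [show 0 ≤ x ^ 4 by positivity]
  · have h1 : 1 ≤ x ^ 2 := by
      rw [← sq_abs]
      nlinarith [not_le.1 hx]
    nlinarith [Real.cos_le_one x]

theorem abs_exp_neg_sub_le {v : ℝ} (hv : 0 ≤ v) : |Real.exp (-v) - (1 - v)| ≤ v ^ 2 := by
  have h0 := Real.add_one_le_exp (-v)
  by_cases h : v ≤ 1
  · have := Real.abs_exp_sub_one_sub_id_le (x := -v) (by rwa [abs_neg, abs_of_nonneg hv])
    rw [neg_sq] at this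
    convert this using 2
    ring
  · rw [abs_of_nonneg (by linarith)]
    nlinarith [Real.exp_le_one_iff.2 (neg_nonpos.2 hv), not_le.1 h]

theorem abs_exp_neg_sub_exp_neg_le {u v : ℝ} (hu : 0 ≤ u) (hv : 0 ≤ v) :
    |Real.exp (-u) - Real.exp (-v)| ≤ |u - v| := by
  wlog h : u ≤ v generalizing u v
  · rw [abs_sub_comm, abs_sub_comm u]
    exact this hv hu (le_of_not_ge h)
  rw [abs_of_nonneg (sub_nonneg.2 (Real.exp_le_exp.2 (neg_le_neg h))), abs_sub_comm,
    abs_of_nonneg (sub_nonneg.2 h)]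
  have h1 := Real.add_one_le_exp (-(v - u))
  have h2 : Real.exp (-v) = Real.exp (-u) * Real.exp (-(v - u)) := by
    rw [← Real.exp_add]
    ring_nf
  have h3 : Real.exp (-u) ≤ 1 := Real.exp_le_one_iff.2 (neg_nonpos.2 hu)
  nlinarith [Real.exp_pos (-u)]

/-- Factors are exchanged one at a time; all others have modulus at most one. -/
theorem abs_prod_sub_prod_le {κ : Type*} (s : Finset κ) {a b : κ → ℝ}
    (ha : ∀ k, |a k| ≤ 1) (hb : ∀ k, |b k| ≤ 1) :
    |∏ k ∈ s, a k - ∏ k ∈ s, b k| ≤ ∑ k ∈ s, |a k - b k| := by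
  classical
  induction s using Finset.induction_on with
  | empty => simp
  | insert c s hc ih =>
    rw [Finset.prod_insert hc, Finset.prod_insert hc, Finset.sum_insert hc]
    have e : a c * ∏ k ∈ s, a k - b c * ∏ k ∈ s, b k =
        a c * (∏ k ∈ s, a k - ∏ k ∈ s, b k) + (a c - b c) * ∏ k ∈ s, b k := by ring
    have h1 : |∏ k ∈ s, b k| ≤ 1 := by
      rw [Finset.abs_prod]
      exact Finset.prod_le_one (fun _ _ => abs_nonneg _) fun k _ => hb k
    rw [e]
    refine (abs_add_le _ _).trans ?_
    rw [abs_mul, abs_mul]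
    have h2 := mul_le_mul (ha c) ih (abs_nonneg _) zero_le_one
    have h3 := mul_le_mul_of_nonneg_left h1 (abs_nonneg (a c - b c))
    linarith

end Analysis


/-! ### Empirical moments and the order of evaluation. -/

/-- The mean of the `p`-th powers of the coordinates. -/
noncomputable def meanPow {d : ℕ} (p : ℕ) (z : Fin d → ℝ) : ℝ := (∑ k, z k ^ p) / d

theorem meanPow_two_nonneg {d : ℕ} (z : Fin d → ℝ) : 0 ≤ meanPow 2 z :=
  div_nonneg (Finset.sum_nonneg fun _ _ => sq_nonneg _) d.cast_nonneg

theorem measurable_meanPow {d : ℕ} (p : ℕ) : Measurable (meanPow p : (Fin d → ℝ) → ℝ) := by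
  unfold meanPow
  fun_prop

/-- The position of a variable in the order of evaluation: sine layer `i` has depth `2 i`,
linear layer `i` has depth `2 i + 1`. -/
def Coord.depth {N din d : ℕ} : Coord N din d → ℕ
  | .input _ => 0
  | .freq _ _ _ => 0
  | .phase i _ => 2 * i
  | .weight i _ _ => 2 * i + 1
  | .bias i _ => 2 * i + 1

/-- The output unit to which a variable contributes. -/
def Coord.unit {N din d : ℕ} : Coord N din d → Option (Fin d)
  | .input _ => none
  | .freq _ j _ => some j
  | .phase _ j => some j
  | .weight _ j _ => some j
  | .bias _ j => some j

theorem integrable_cos {Ω : Type*} [MeasurableSpace Ω] {P : Measure Ω} [IsFiniteMeasure P]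
    {X : Ω → ℝ} (hX : Measurable X) : Integrable (fun w => Real.cos (X w)) P :=
  Integrable.of_bound (C := 1) (Real.measurable_cos.comp hX).aestronglyMeasurable
    (ae_of_all _ fun _ => Real.abs_cos_le_one _)

theorem integrable_sin {Ω : Type*} [MeasurableSpace Ω] {P : Measure Ω} [IsFiniteMeasure P]
    {X : Ω → ℝ} (hX : Measurable X) : Integrable (fun w => Real.sin (X w)) P :=
  Integrable.of_bound (C := 1) (Real.measurable_sin.comp hX).aestronglyMeasurable
    (ae_of_all _ fun _ => Real.abs_sin_le_one _)

/-! ### One layer applied to a fixed hidden state. -/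

section OneLayer

variable {N din d : ℕ} {Ω : Type*} [MeasurableSpace Ω] {P : Measure Ω}
  {η : Coord N din d → Ω → ℝ} {β : ℝ}

theorem measurable_linearLayer_uncurry (i : Fin N) (j : Fin d) :
    Measurable fun p : (Fin d → ℝ) × (Coord N din d → ℝ) => linearLayer p.2 i p.1 j := by
  unfold linearLayer
  fun_prop

theorem measurable_linearLayer (i : Fin N) (z : Fin d → ℝ) (j : Fin d) :
    Measurable fun x : Coord N din d → ℝ => linearLayer x i z j :=
  (measurable_linearLayer_uncurry i j).comp measurable_prodMk_left

theorem dependsOn_linearLayer (i : Fin N) (z : Fin d → ℝ) (j : Fin d) :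
    DependsOn (fun x : Coord N din d → ℝ => linearLayer x i z j)
      {c | c.depth = 2 * i + 1 ∧ c.unit = some j} := fun x y h => by
  simp only [linearLayer]
  rw [h (.bias i j) ⟨rfl, rfl⟩]
  congr 1
  exact Finset.sum_congr rfl fun k _ => by rw [h (.weight i j k) ⟨rfl, rfl⟩]

namespace IsSineFamily

variable (hη : IsSineFamily η P β)
include hη

theorem memLp_phase (i : Fin (N + 1)) (j : Fin d) : MemLp (η (.phase i j)) ⊤ P :=
  memLp_top_of_abs_le (hη.measurable _) (hη.phase_le i j)

theorem memLp_weight (i : Fin N) (j k : Fin d) : MemLp (η (.weight i j k)) ⊤ P :=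
  memLp_top_of_abs_le (hη.measurable _) (hη.weight_le i j k)

theorem memLp_bias (i : Fin N) (j : Fin d) : MemLp (η (.bias i j)) ⊤ P :=
  memLp_top_of_abs_le (hη.measurable _) (hη.bias_le i j)

theorem memLp_linearLayer {Z : Ω → Fin d → ℝ} (hZ : ∀ k, MemLp (fun w => Z w k) ⊤ P)
    (i : Fin N) (j : Fin d) : MemLp (fun w => linearLayer (fun c => η c w) i (Z w) j) ⊤ P :=
  (memLp_finsetSum _ fun k _ => memLp_top_mul (hη.memLp_weight i j k) (hZ k)).add
    (hη.memLp_bias i j)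

theorem memLp_linearLayer_const [IsFiniteMeasure P] (i : Fin N) (z : Fin d → ℝ) (j : Fin d) :
    MemLp (fun w => linearLayer (fun c => η c w) i z j) ⊤ P :=
  hη.memLp_linearLayer (Z := fun _ => z) (fun k => memLp_const (z k)) i j

theorem memLp_sum_weight [IsFiniteMeasure P] (i : Fin N) (z : Fin d → ℝ) (j : Fin d) :
    MemLp (fun w => ∑ k, η (.weight i j k) w * z k) ⊤ P :=
  memLp_finsetSum _ fun k _ => memLp_top_mul (hη.memLp_weight i j k) (memLp_const _)

/-- Since $W^2\le 6/d$ almost surely, $\mathbb E W^4\le (6/d)(2/d)$, exactly the kurtosis bound $3$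
needed by `moments_sum_of_iIndepFun`. -/
theorem weight_pow_four_le [IsFiniteMeasure P] (i : Fin N) (j k : Fin d) :
    ∫ w, η (.weight i j k) w ^ 4 ∂P ≤ 3 * (2 / (d : ℝ)) ^ 2 := by
  have h : ∫ w, η (.weight i j k) w ^ 4 ∂P ≤ ∫ w, 6 / (d : ℝ) * η (.weight i j k) w ^ 2 ∂P := by
    refine integral_mono_ae (memLp_top_pow (hη.memLp_weight i j k) 4).integrable_of_top
      ((memLp_top_pow (hη.memLp_weight i j k) 2).const_mul _).integrable_of_top ?_
    filter_upwards [hη.weight_le i j k] with w hw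
    have h2 : η (.weight i j k) w ^ 2 ≤ 6 / (d : ℝ) := by
      rw [← sq_abs]
      exact (pow_le_pow_left₀ (abs_nonneg _) hw 2).trans_eq (Real.sq_sqrt (by positivity))
    nlinarith [sq_nonneg (η (.weight i j k) w)]
  rw [integral_const_mul, hη.weight_sq] at h
  refine h.trans_eq ?_
  ring

theorem moments_sum_weight [IsProbabilityMeasure P] (i : Fin N) (z : Fin d → ℝ) (j : Fin d) :
    ∫ w, ∑ k, η (.weight i j k) w * z k ∂P = 0 ∧
      ∫ w, (∑ k, η (.weight i j k) w * z k) ^ 2 ∂P = 2 * meanPow 2 z ∧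
      ∫ w, (∑ k, η (.weight i j k) w * z k) ^ 4 ∂P ≤ 12 * meanPow 2 z ^ 2 := by
  have hi : iIndepFun (fun k w => η (.weight i j k) w * z k) P :=
    (hη.indep.precomp (g := fun k => Coord.weight i j k) fun k l h => by simpa using h).comp
      (fun k x => x * z k) fun k => by fun_prop
  have h := moments_sum_of_iIndepFun hi (fun k => (hη.measurable _).mul_const _)
    (fun k => memLp_top_mul (hη.memLp_weight i j k) (memLp_const _))
    (fun k => by rw [integral_mul_const, hη.weight_mean, zero_mul])
    (v := fun k => 2 / (d : ℝ) * z k ^ 2)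
    (fun k => by simp only [mul_pow]; rw [integral_mul_const, hη.weight_sq])
    (fun k => by
      simp only [mul_pow]
      rw [integral_mul_const]
      refine (mul_le_mul_of_nonneg_right (hη.weight_pow_four_le i j k)
        (by positivity)).trans_eq ?_
      ring)
    Finset.univ
  have e : ∑ k, 2 / (d : ℝ) * z k ^ 2 = 2 * meanPow 2 z := by
    rw [← Finset.mul_sum, meanPow]
    ring
  rw [e] at h
  refine ⟨h.1, h.2.1, h.2.2.trans_eq ?_⟩
  ring

theorem abs_integral_bias_le [IsProbabilityMeasure P] (i : Fin N) (j : Fin d) :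
    |∫ w, η (.bias i j) w ∂P| ≤ β := by
  simpa using norm_integral_le_of_norm_le_const (f := η (.bias i j)) (hη.bias_le i j)

theorem integral_bias_pow_le [IsProbabilityMeasure P] (i : Fin N) (j : Fin d) (n : ℕ) :
    ∫ w, η (.bias i j) w ^ n ∂P ≤ β ^ n := by
  refine (le_abs_self _).trans ?_
  have := norm_integral_le_of_norm_le_const (μ := P) (f := fun w => η (.bias i j) w ^ n)
    (C := β ^ n) (by
      filter_upwards [hη.bias_le i j] with w hw
      rw [norm_pow]
      exact pow_le_pow_left₀ (abs_nonneg _) hw n)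
  simpa using this

theorem indepFun_sum_weight_bias (i : Fin N) (z : Fin d → ℝ) (j : Fin d) :
    IndepFun (fun w => ∑ k, η (.weight i j k) w * z k) (η (.bias i j)) P :=
  indepFun_of_dependsOn hη.indep hη.measurable
    (f := fun x => ∑ k, x (.weight i j k) * z k) (g := fun x => x (.bias i j))
    (by fun_prop) (by fun_prop) (S := Set.range fun k => Coord.weight i j k) (T := {.bias i j})
    (fun x y h => Finset.sum_congr rfl fun k _ => by rw [h _ ⟨k, rfl⟩])
    (fun x y h => h _ rfl) (by simp)

theorem integral_linearLayer [IsProbabilityMeasure P] (i : Fin N) (z : Fin d → ℝ) (j : Fin d) :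
    ∫ w, linearLayer (fun c => η c w) i z j ∂P = ∫ w, η (.bias i j) w ∂P := by
  simp only [linearLayer]
  rw [integral_add (hη.memLp_sum_weight i z j).integrable_of_top
    (hη.memLp_bias i j).integrable_of_top, (hη.moments_sum_weight i z j).1, zero_add]

theorem integral_linearLayer_sq [IsProbabilityMeasure P] (i : Fin N) (z : Fin d → ℝ)
    (j : Fin d) :
    ∫ w, linearLayer (fun c => η c w) i z j ^ 2 ∂P =
      2 * meanPow 2 z + ∫ w, η (.bias i j) w ^ 2 ∂P := by
  simp only [linearLayer]
  rw [integral_add_sq_of_indepFun (hη.memLp_sum_weight i z j) (hη.memLp_bias i j)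
    (hη.indepFun_sum_weight_bias i z j) (hη.moments_sum_weight i z j).1,
    (hη.moments_sum_weight i z j).2.1]

theorem integral_linearLayer_pow_four_le [IsProbabilityMeasure P] (i : Fin N) (z : Fin d → ℝ)
    (j : Fin d) :
    ∫ w, linearLayer (fun c => η c w) i z j ^ 4 ∂P ≤ 8 * (12 * meanPow 2 z ^ 2 + β ^ 4) := by
  have i1 := (memLp_top_pow (hη.memLp_sum_weight i z j) 4).integrable_of_top
  have i2 := (memLp_top_pow (hη.memLp_bias i j) 4).integrable_of_top
  have h : ∫ w, linearLayer (fun c => η c w) i z j ^ 4 ∂P ≤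
      ∫ w, 8 * ((∑ k, η (.weight i j k) w * z k) ^ 4 + η (.bias i j) w ^ 4) ∂P := by
    refine integral_mono
      (memLp_top_pow (hη.memLp_linearLayer_const i z j) 4).integrable_of_top
      ((i1.add i2).const_mul 8) fun w => ?_
    -- Convexity: $(x+y)^4\le 2^3(x^4+y^4)$.
    exact (Even.add_pow_le (show Even 4 by decide)).trans_eq (by norm_num)
  rw [integral_const_mul, integral_add i1 i2] at h
  linarith [(hη.moments_sum_weight i z j).2.2, hη.integral_bias_pow_le i j 4]

theorem indepFun_phase_linearLayer (i : Fin N) (z : Fin d → ℝ) (j : Fin d) :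
    IndepFun (η (.phase i.succ j)) (fun w => linearLayer (fun c => η c w) i z j) P :=
  indepFun_of_dependsOn hη.indep hη.measurable (f := fun x => x (.phase i.succ j)) (by fun_prop)
    (measurable_linearLayer i z j) (S := {.phase i.succ j}) (fun x y h => h _ rfl)
    (dependsOn_linearLayer i z j) (by
      simp only [Set.disjoint_singleton_left, Set.mem_ofPred_eq, Coord.depth]
      omega)

/-- The outputs of the multiplicative layer fed with a fixed hidden state. -/
theorem integral_product [IsProbabilityMeasure P] (i : Fin N) (z : Fin d → ℝ) (j : Fin d) :
    ∫ w, η (.phase i.succ j) w * linearLayer (fun c => η c w) i z j ∂P = 0 := by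
  rw [(hη.indepFun_phase_linearLayer i z j).integral_fun_mul_eq_mul_integral
    (hη.memLp_phase _ _).1 (hη.memLp_linearLayer_const i z j).1,
    hη.phase_mean, zero_mul]

theorem integral_product_sq [IsProbabilityMeasure P] (i : Fin N) (z : Fin d → ℝ) (j : Fin d) :
    ∫ w, (η (.phase i.succ j) w * linearLayer (fun c => η c w) i z j) ^ 2 ∂P =
      meanPow 2 z + (∫ w, η (.bias i j) w ^ 2 ∂P) / 2 := by
  simp only [mul_pow]
  have h : IndepFun (fun w => η (.phase i.succ j) w ^ 2)
      (fun w => linearLayer (fun c => η c w) i z j ^ 2) P :=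
    (hη.indepFun_phase_linearLayer i z j).comp (measurable_id.pow_const 2)
      (measurable_id.pow_const 2)
  rw [h.integral_fun_mul_eq_mul_integral (memLp_top_pow (hη.memLp_phase _ _) 2).1
    (memLp_top_pow (hη.memLp_linearLayer_const i z j) 2).1]
  rw [hη.phase_sq, hη.integral_linearLayer_sq]
  ring

theorem memLp_product {Z : Ω → Fin d → ℝ} (hZ : ∀ k, MemLp (fun w => Z w k) ⊤ P)
    (i : Fin N) (j : Fin d) :
    MemLp (fun w => η (.phase i.succ j) w * linearLayer (fun c => η c w) i (Z w) j) ⊤ P :=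
  memLp_top_mul (hη.memLp_phase _ _) (hη.memLp_linearLayer hZ i j)

theorem memLp_product_const [IsFiniteMeasure P] (i : Fin N) (z : Fin d → ℝ) (j : Fin d) :
    MemLp (fun w => η (.phase i.succ j) w * linearLayer (fun c => η c w) i z j) ⊤ P :=
  hη.memLp_product (Z := fun _ => z) (fun k => memLp_const (z k)) i j

theorem integral_product_pow_four_le [IsProbabilityMeasure P] (i : Fin N) (z : Fin d → ℝ)
    (j : Fin d) :
    ∫ w, (η (.phase i.succ j) w * linearLayer (fun c => η c w) i z j) ^ 4 ∂P ≤
      8 * (12 * meanPow 2 z ^ 2 + β ^ 4) := by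
  refine le_trans ?_ (hη.integral_linearLayer_pow_four_le i z j)
  refine integral_mono_ae
    (memLp_top_pow (hη.memLp_product_const i z j) 4).integrable_of_top
    (memLp_top_pow (hη.memLp_linearLayer_const i z j) 4).integrable_of_top ?_
  filter_upwards [hη.phase_le i.succ j] with w hw
  have h : η (.phase i.succ j) w ^ 4 ≤ 1 := by
    rw [← (show Even 4 by decide).pow_abs]
    exact pow_le_one₀ (abs_nonneg _) hw
  rw [mul_pow]
  exact mul_le_of_le_one_left (by positivity) h

/-- One layer nearly preserves the mean square. -/
theorem integral_meanPow_product_sub_sq_le [IsProbabilityMeasure P] (hd : 0 < d) (i : Fin N)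
    (z : Fin d → ℝ) :
    ∫ w, (meanPow 2 (fun j => η (.phase i.succ j) w * linearLayer (fun c => η c w) i z j)
      - meanPow 2 z) ^ 2 ∂P ≤ 8 / d * (12 * meanPow 2 z ^ 2 + β ^ 4) + β ^ 4 / 4 := by
  have hd' : (0 : ℝ) < d := by exact_mod_cast hd
  let Y : Fin d → Ω → ℝ := fun j w =>
    (η (.phase i.succ j) w * linearLayer (fun c => η c w) i z j) ^ 2
  have hY (j) : MemLp (Y j) ⊤ P :=
    memLp_top_pow (hη.memLp_product_const i z j) 2
  have hind (j j' : Fin d) (hjj : j ≠ j') : IndepFun (Y j) (Y j') P := by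
    -- For fixed $z$, distinct output units use disjoint sets of variables, hence the squares are
    -- independent and variances add.
    have hdep (j : Fin d) : DependsOn (fun x : Coord N din d → ℝ =>
        (x (.phase i.succ j) * linearLayer x i z j) ^ 2) {c | c.unit = some j} :=
      fun x y h => by
        simp only
        have h' : linearLayer x i z j = linearLayer y i z j :=
          dependsOn_linearLayer i z j fun c hc => h c hc.2
        rw [h (.phase i.succ j) rfl, h']
    have hmeas (j : Fin d) : Measurable (fun x : Coord N din d → ℝ =>
        (x (.phase i.succ j) * linearLayer x i z j) ^ 2) :=
      ((measurable_pi_apply _).mul (measurable_linearLayer i z j)).pow_const 2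
    refine indepFun_of_dependsOn hη.indep hη.measurable (hmeas j) (hmeas j') (hdep j) (hdep j') ?_
    rw [Set.disjoint_left]
    intro c hc hc'
    exact hjj (Option.some.inj (hc.symm.trans hc'))
  let M : Ω → ℝ := fun w => ∑ j, Y j w
  have hM : MemLp M ⊤ P := memLp_finsetSum _ fun j _ => hY j
  have hvar : Var[M; P] ≤ d * (8 * (12 * meanPow 2 z ^ 2 + β ^ 4)) := by
    have h := IndepFun.variance_sum (μ := P) (X := Y) (s := Finset.univ)
      (fun j _ => (hY j).mono_exponent le_top) (fun j _ j' _ h => hind j j' h)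
    have e : M = ∑ j, Y j := by
      ext w
      simp [M]
    rw [e, h]
    refine (Finset.sum_le_card_nsmul _ _ (8 * (12 * meanPow 2 z ^ 2 + β ^ 4)) fun j _ => ?_).trans_eq
      (by simp)
    refine (variance_le_expectation_sq (hY j).1).trans ?_
    refine le_of_eq_of_le ?_ (hη.integral_product_pow_four_le i z j)
    refine integral_congr_ae (ae_of_all _ fun w => ?_)
    simp only [Y, Pi.pow_apply]
    ring
  -- `R` is the drift of the sum of squares caused by the biases; after division by $d$ it is at
  -- most $\beta^2/2$.
  let R : ℝ := (∑ j, ∫ w, η (.bias i j) w ^ 2 ∂P) / 2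
  have hR0 : 0 ≤ R := by
    have h (j : Fin d) : 0 ≤ ∫ w, η (.bias i j) w ^ 2 ∂P := integral_nonneg fun _ => sq_nonneg _
    exact div_nonneg (Finset.sum_nonneg fun j _ => h j) zero_le_two
  have hR : R ≤ d * (β ^ 2 / 2) := by
    have := Finset.sum_le_card_nsmul Finset.univ _ (β ^ 2) fun (j : Fin d) _ =>
      hη.integral_bias_pow_le i j 2
    simp only [Finset.card_univ, Fintype.card_fin, nsmul_eq_mul] at this
    simp only [R]
    linarith
  have hmean : ∫ w, M w ∂P = d * meanPow 2 z + R := by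
    simp only [M]
    rw [integral_finsetSum _ fun j _ => (hY j).integrable_of_top]
    simp only [Y, hη.integral_product_sq, Finset.sum_add_distrib, Finset.sum_const,
      Finset.card_univ, Fintype.card_fin, nsmul_eq_mul, R, Finset.sum_div]
  -- Bias-variance decomposition around the true mean of `M`.
  have hM2 : ∫ w, (M w - d * meanPow 2 z) ^ 2 ∂P = Var[M; P] + R ^ 2 := by
    rw [variance_eq_integral hM.1.aemeasurable, hmean]
    have e (w) : (M w - d * meanPow 2 z) ^ 2 =
        (M w - (d * meanPow 2 z + R)) ^ 2 + (2 * R * (M w - (d * meanPow 2 z + R)) + R ^ 2) := by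
      ring
    simp only [e]
    have i0 : Integrable (fun w => M w - (d * meanPow 2 z + R)) P :=
      hM.integrable_of_top.sub (integrable_const _)
    have i1 : Integrable (fun w => (M w - (d * meanPow 2 z + R)) ^ 2) P :=
      (memLp_top_pow (hM.sub (memLp_const _)) 2).integrable_of_top
    rw [integral_add i1 ((i0.const_mul _).fun_add (integrable_const _)), integral_add (i0.const_mul _)
      (integrable_const _), integral_const_mul,
      integral_sub hM.integrable_of_top (integrable_const _), hmean]
    simp
  have hfin : ∫ w, (meanPow 2 (fun j => η (.phase i.succ j) w *
      linearLayer (fun c => η c w) i z j) - meanPow 2 z) ^ 2 ∂P =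
      (1 / d) ^ 2 * ∫ w, (M w - d * meanPow 2 z) ^ 2 ∂P := by
    rw [← integral_const_mul]
    refine integral_congr_ae (ae_of_all _ fun w => ?_)
    simp only [meanPow, M, Y]
    field_simp
  have hR2 : R ^ 2 ≤ (d * (β ^ 2 / 2)) ^ 2 := pow_le_pow_left₀ hR0 hR 2
  rw [hfin, hM2]
  calc (1 / (d : ℝ)) ^ 2 * (Var[M; P] + R ^ 2)
      ≤ (1 / (d : ℝ)) ^ 2 * (d * (8 * (12 * meanPow 2 z ^ 2 + β ^ 4)) + (d * (β ^ 2 / 2)) ^ 2) := by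
        gcongr
    _ = _ := by field_simp; ring

/-- The characteristic function of a weight is real. -/
theorem integral_exp_weight [IsFiniteMeasure P] (i : Fin N) (j k : Fin d) (t : ℝ) :
    ∫ w, Complex.exp ((t * η (.weight i j k) w : ℝ) * Complex.I) ∂P =
      ((∫ w, Real.cos (t * η (.weight i j k) w) ∂P : ℝ) : ℂ) := by
  have hm := hη.measurable (.weight i j k)
  have i1 : Integrable (fun w => ((Real.cos (t * η (.weight i j k) w) : ℝ) : ℂ)) P :=
    (integrable_cos (by fun_prop)).ofReal
  have i2 : Integrable (fun w => ((Real.sin (t * η (.weight i j k) w) : ℝ) : ℂ)) P :=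
    (integrable_sin (by fun_prop)).ofReal
  simp only [Complex.exp_mul_I, ← Complex.ofReal_cos, ← Complex.ofReal_sin]
  rw [integral_add i1 (i2.mul_const _), integral_mul_const, integral_complex_ofReal,
    integral_complex_ofReal, hη.weight_sin]
  simp

/-- Both terms are compared with $1-t^2/d$. The cosine costs $3t^4\cdot 12/d^2$ and the exponential
$(t^2/d)^2$, whence $37=36+1$. -/
theorem abs_integral_cos_weight_sub_le [IsProbabilityMeasure P] (i : Fin N) (j k : Fin d)
    (t : ℝ) :
    |∫ w, Real.cos (t * η (.weight i j k) w) ∂P - Real.exp (-(t ^ 2 / d))| ≤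
      37 * t ^ 4 / d ^ 2 := by
  have hm := hη.measurable (.weight i j k)
  have h2 := (memLp_top_pow (hη.memLp_weight i j k) 2).integrable_of_top
  have h4 := (memLp_top_pow (hη.memLp_weight i j k) 4).integrable_of_top
  have hc : Integrable (fun w => Real.cos (t * η (.weight i j k) w)) P :=
    integrable_cos (by fun_prop)
  have e : ∫ w, Real.cos (t * η (.weight i j k) w) ∂P - (1 - t ^ 2 / d) =
      ∫ w, (Real.cos (t * η (.weight i j k) w) - (1 - t ^ 2 / 2 * η (.weight i j k) w ^ 2)) ∂P := by
    have h1 : Integrable (fun w => 1 - t ^ 2 / 2 * η (.weight i j k) w ^ 2) P :=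
      (integrable_const _).sub (h2.const_mul _)
    rw [integral_sub hc h1,
      integral_sub (integrable_const _) (h2.const_mul _), integral_const_mul, hη.weight_sq]
    simp
    ring
  have b1 : |∫ w, Real.cos (t * η (.weight i j k) w) ∂P - (1 - t ^ 2 / d)| ≤
      36 * t ^ 4 / d ^ 2 := by
    rw [e, ← Real.norm_eq_abs]
    refine (norm_integral_le_of_norm_le (h4.const_mul (3 * t ^ 4)) (ae_of_all _ fun w => ?_)).trans
      ?_
    · refine le_trans (le_of_eq ?_) ((abs_cos_sub_le (t * η (.weight i j k) w)).trans_eq (by ring))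
      rw [Real.norm_eq_abs]
      congr 1
      ring
    · rw [integral_const_mul]
      refine (mul_le_mul_of_nonneg_left (hη.weight_pow_four_le i j k) (by positivity)).trans_eq ?_
      ring
  have b2 := abs_exp_neg_sub_le (v := t ^ 2 / d) (by positivity)
  rw [abs_sub_comm] at b2
  refine (abs_sub_le _ _ _).trans ((add_le_add b1 b2).trans_eq ?_)
  ring

theorem norm_integral_exp_bias_sub_one_le [IsProbabilityMeasure P] (i : Fin N) (j : Fin d)
    (t : ℝ) :
    ‖∫ w, Complex.exp ((t * η (.bias i j) w : ℝ) * Complex.I) ∂P - 1‖ ≤ |t| * β := by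
  have hm := hη.measurable (.bias i j)
  have hi : Integrable (fun w => Complex.exp ((t * η (.bias i j) w : ℝ) * Complex.I)) P :=
    Integrable.of_bound (C := 1) (by fun_prop) (ae_of_all _ fun w => by
      rw [Complex.norm_exp_ofReal_mul_I])
  have e : ∫ w, Complex.exp ((t * η (.bias i j) w : ℝ) * Complex.I) ∂P - 1 =
      ∫ w, (Complex.exp ((t * η (.bias i j) w : ℝ) * Complex.I) - 1) ∂P := by
    rw [integral_sub hi (integrable_const _)]
    simp
  rw [e]
  have := norm_integral_le_of_norm_le_const (μ := P) (C := |t| * β)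
    (f := fun w => Complex.exp ((t * η (.bias i j) w : ℝ) * Complex.I) - 1) (by
      filter_upwards [hη.bias_le i j] with w hw
      have h := Real.norm_exp_I_mul_ofReal_sub_one_le (x := t * η (.bias i j) w)
      rw [mul_comm Complex.I, Real.norm_eq_abs, abs_mul] at h
      exact h.trans (mul_le_mul_of_nonneg_left hw (abs_nonneg _)))
  simpa using this

/-- The characteristic function of one preactivation is nearly Gaussian. -/
theorem norm_integral_exp_linearLayer_sub_le [IsProbabilityMeasure P] (i : Fin N)
    (z : Fin d → ℝ) (j : Fin d) (t : ℝ) :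
    ‖∫ w, Complex.exp ((t * linearLayer (fun c => η c w) i z j : ℝ) * Complex.I) ∂P
      - (Real.exp (-(t ^ 2 * meanPow 2 z)) : ℝ)‖ ≤ 37 * t ^ 4 / d * meanPow 4 z + |t| * β := by
  have hm := hη.measurable
  let φ : Fin d → ℝ := fun k => ∫ w, Real.cos (t * z k * η (.weight i j k) w) ∂P
  have hφ (k) : |φ k| ≤ 1 := by
    simpa using norm_integral_le_of_norm_le_const (μ := P) (C := 1)
      (f := fun w => Real.cos (t * z k * η (.weight i j k) w))
      (ae_of_all _ fun w => Real.abs_cos_le_one _)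
  have hE (k) : |Real.exp (-((t * z k) ^ 2 / d))| ≤ 1 := by
    rw [Real.abs_exp, Real.exp_le_one_iff, neg_nonpos]
    positivity
  have hprod : ∫ w, Complex.exp ((t * ∑ k, η (.weight i j k) w * z k : ℝ) * Complex.I) ∂P =
      ((∏ k, φ k : ℝ) : ℂ) := by
    have hi : iIndepFun (fun k w =>
        Complex.exp ((t * z k * η (.weight i j k) w : ℝ) * Complex.I)) P :=
      (hη.indep.precomp (g := fun k => Coord.weight i j k) fun k l h => by simpa using h).comp
        (fun k x => Complex.exp ((t * z k * x : ℝ) * Complex.I)) fun k => by fun_prop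
    have h := hi.integral_fun_prod_eq_prod_integral fun k =>
      (Measurable.aestronglyMeasurable (by fun_prop))
    simp only [hη.integral_exp_weight] at h
    rw [Complex.ofReal_prod, ← h]
    refine integral_congr_ae (ae_of_all _ fun w => ?_)
    simp only
    rw [← Complex.exp_sum, ← Finset.sum_mul, ← Complex.ofReal_sum, Finset.mul_sum]
    congr 3
    exact Finset.sum_congr rfl fun k _ => by ring
  have hsplit : ∫ w, Complex.exp ((t * linearLayer (fun c => η c w) i z j : ℝ) * Complex.I) ∂P =
      ((∏ k, φ k : ℝ) : ℂ) * ∫ w, Complex.exp ((t * η (.bias i j) w : ℝ) * Complex.I) ∂P := by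
    have hi : IndepFun
        (fun w => Complex.exp ((t * ∑ k, η (.weight i j k) w * z k : ℝ) * Complex.I))
        (fun w => Complex.exp ((t * η (.bias i j) w : ℝ) * Complex.I)) P :=
      (hη.indepFun_sum_weight_bias i z j).comp
        (φ := fun x : ℝ => Complex.exp ((t * x : ℝ) * Complex.I))
        (ψ := fun x : ℝ => Complex.exp ((t * x : ℝ) * Complex.I)) (by fun_prop) (by fun_prop)
    rw [← hprod, ← hi.integral_fun_mul_eq_mul_integral
      (Measurable.aestronglyMeasurable (by fun_prop))
      (Measurable.aestronglyMeasurable (by fun_prop))]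
    refine integral_congr_ae (ae_of_all _ fun w => ?_)
    simp only [linearLayer]
    rw [← Complex.exp_add, ← add_mul, ← Complex.ofReal_add, mul_add]
  have hexp : Real.exp (-(t ^ 2 * meanPow 2 z)) = ∏ k, Real.exp (-((t * z k) ^ 2 / d)) := by
    rw [← Real.exp_sum]
    congr 1
    simp only [meanPow, Finset.sum_neg_distrib, mul_pow, mul_div_assoc, ← Finset.mul_sum,
      Finset.sum_div]
  -- The Gaussian also factors over $k$, so the product comparison reduces everything to single
  -- weights.
  have hb : ‖((∏ k, φ k : ℝ) : ℂ) - (Real.exp (-(t ^ 2 * meanPow 2 z)) : ℝ)‖ ≤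
      37 * t ^ 4 / d * meanPow 4 z := by
    rw [← Complex.ofReal_sub, Complex.norm_real, hexp]
    refine (abs_prod_sub_prod_le _ hφ hE).trans ((Finset.sum_le_sum fun k _ =>
      hη.abs_integral_cos_weight_sub_le i j k (t * z k)).trans_eq ?_)
    simp only [meanPow, mul_pow, Finset.sum_div, Finset.mul_sum]
    exact Finset.sum_congr rfl fun k _ => by ring
  have hφ1 : ‖((∏ k, φ k : ℝ) : ℂ)‖ ≤ 1 := by
    rw [Complex.norm_real, norm_prod]
    exact Finset.prod_le_one (fun _ _ => norm_nonneg _) fun k _ => hφ k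
  have hb2 := hη.norm_integral_exp_bias_sub_one_le i j t
  rw [hsplit]
  set I := ∫ w, Complex.exp ((t * η (.bias i j) w : ℝ) * Complex.I) ∂P
  have e : ((∏ k, φ k : ℝ) : ℂ) * I - (Real.exp (-(t ^ 2 * meanPow 2 z)) : ℝ) =
      (((∏ k, φ k : ℝ) : ℂ) - (Real.exp (-(t ^ 2 * meanPow 2 z)) : ℝ)) +
        ((∏ k, φ k : ℝ) : ℂ) * (I - 1) := by ring
  rw [e]
  refine (norm_add_le _ _).trans (add_le_add hb ?_)
  rw [norm_mul]
  exact (mul_le_of_le_one_left (norm_nonneg _) hφ1).trans hb2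

end IsSineFamily

end OneLayer


/-- This is nonnegativity of the variance of $|X|$. -/
theorem integral_abs_le_sqrt {Ω : Type*} [MeasurableSpace Ω] {P : Measure Ω}
    [IsProbabilityMeasure P] {X : Ω → ℝ} (hX : MemLp X 2 P) :
    ∫ w, |X w| ∂P ≤ √(∫ w, X w ^ 2 ∂P) := by
  have h := variance_nonneg |X| P
  rw [variance_eq_sub hX.abs] at h
  simp only [Pi.pow_apply, Pi.abs_apply, sq_abs] at h
  exact Real.le_sqrt_of_sq_le (sub_nonneg.1 h)

/-! ### Hidden states as functions of the independent family. -/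

section Hidden

variable {N din d : ℕ}

/-- The hidden states as functions of the outputs of the sine layers, weights and biases. -/
noncomputable def sineHidden (x : Coord N din d → ℝ) (i : Fin (N + 1)) : Fin d → ℝ :=
  Fin.induction (motive := fun _ => Fin d → ℝ) (fun j => x (.phase 0 j))
    (fun i z j => x (.phase i.succ j) * linearLayer x i z j) i

theorem sineHidden_zero (x : Coord N din d → ℝ) : sineHidden x 0 = fun j => x (.phase 0 j) := rfl

theorem sineHidden_succ (x : Coord N din d → ℝ) (i : Fin N) :
    sineHidden x i.succ = fun j =>
      x (.phase i.succ j) * linearLayer x i (sineHidden x i.castSucc) j := by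
  simp [sineHidden, Fin.induction_succ]

theorem linearLayer_sineFamily (θ : Coord N din d → ℝ) (i : Fin N) (z : Fin d → ℝ) :
    linearLayer (sineFamily θ) i z = linearLayer θ i z := rfl

theorem sineHidden_sineFamily (θ : Coord N din d → ℝ) (i : Fin (N + 1)) :
    sineHidden (sineFamily θ) i = hidden θ i := by
  induction i using Fin.induction with
  | zero => rfl
  | succ i ih =>
    ext j
    rw [sineHidden_succ, hidden_succ, ih, linearLayer_sineFamily]
    rfl

theorem measurable_sineHidden (i : Fin (N + 1)) :
    Measurable fun x : Coord N din d → ℝ => sineHidden x i := by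
  induction i using Fin.induction with
  | zero =>
    simp only [sineHidden_zero]
    fun_prop
  | succ i ih =>
    simp only [sineHidden_succ]
    exact measurable_pi_lambda _ fun j => (measurable_pi_apply _).mul
      ((measurable_linearLayer_uncurry i j).comp (ih.prodMk measurable_id))

/-- Depth at most $2i$ is complementary to the depths above $2i$ used by the next layer; this
disjointness permits resampling. -/
theorem dependsOn_sineHidden (i : Fin (N + 1)) :
    DependsOn (fun x : Coord N din d → ℝ => sineHidden x i) {c | c.depth ≤ 2 * i} := by
  induction i using Fin.induction with
  | zero =>
    intro x y h
    exact funext fun j => h (.phase 0 j) (le_refl (2 * 0))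
  | succ i ih =>
    intro x y h
    have h1 : sineHidden x i.castSucc = sineHidden y i.castSucc := ih fun c hc => h c (by
      simp only [Set.mem_ofPred_eq, Fin.val_castSucc, Fin.val_succ] at hc ⊢
      omega)
    simp only [sineHidden_succ]
    ext j
    have h2 : linearLayer x i (sineHidden y i.castSucc) j =
        linearLayer y i (sineHidden y i.castSucc) j :=
      dependsOn_linearLayer i _ j fun c hc => h c (by
        simp only [Set.mem_ofPred_eq, Fin.val_succ] at hc ⊢
        omega)
    rw [h1, h2, h (.phase i.succ j) (le_refl (2 * _))]

theorem memLp_meanPow {Ω : Type*} [MeasurableSpace Ω] {P : Measure Ω} [IsFiniteMeasure P] {Z : Ω → Fin d → ℝ}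
    (hZ : ∀ k, MemLp (fun w => Z w k) ⊤ P) (p : ℕ) : MemLp (fun w => meanPow p (Z w)) ⊤ P := by
  simp only [meanPow, div_eq_mul_inv]
  exact memLp_top_mul (memLp_finsetSum _ fun k _ => memLp_top_pow (hZ k) p) (memLp_const _)

theorem dependsOn_linearLayer_resample (i : Fin N) (z : Fin d → ℝ) (j : Fin d) :
    DependsOn (fun x : Coord N din d → ℝ => linearLayer x i z j)
      {c | 2 * (i : ℕ) < c.depth} :=
  (dependsOn_linearLayer i z j).mono fun c hc => by
    simp only [Set.mem_ofPred_eq] at hc ⊢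
    omega

theorem dependsOn_product_resample (i : Fin N) (z : Fin d → ℝ) (j : Fin d) :
    DependsOn (fun x : Coord N din d → ℝ => x (.phase i.succ j) * linearLayer x i z j)
      {c | 2 * (i : ℕ) < c.depth} := fun x y h => by
  have h1 : linearLayer x i z j = linearLayer y i z j := by
    exact dependsOn_linearLayer_resample i z j h
  simp only
  rw [h1, h (.phase i.succ j) (by simp [Coord.depth])]

theorem measurable_product_uncurry (i : Fin N) (j : Fin d) :
    Measurable fun p : (Fin d → ℝ) × (Coord N din d → ℝ) =>
      p.2 (.phase i.succ j) * linearLayer p.2 i p.1 j :=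
  ((measurable_pi_apply _).comp measurable_snd).mul (measurable_linearLayer_uncurry i j)

end Hidden

/-! ### Estimates averaged over the random hidden state. -/

namespace IsSineFamily

variable {N din d : ℕ} {Ω : Type*} [MeasurableSpace Ω] {P : Measure Ω}
  {η : Coord N din d → Ω → ℝ} {β : ℝ} (hη : IsSineFamily η P β)
include hη

theorem memLp_sineHidden (i : Fin (N + 1)) (j : Fin d) :
    MemLp (fun w => sineHidden (fun c => η c w) i j) ⊤ P := by
  induction i using Fin.induction generalizing j with
  | zero => exact hη.memLp_phase 0 j
  | succ i ih =>
    simp only [sineHidden_succ]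
    exact hη.memLp_product ih i j

/-- Given the hidden state, the next layers can be resampled. -/
theorem integral_resample [IsProbabilityMeasure P] {E : Type*} [NormedAddCommGroup E]
    [NormedSpace ℝ E] (i : Fin N) {G : (Fin d → ℝ) → (Coord N din d → ℝ) → E}
    (hG : StronglyMeasurable (Function.uncurry G))
    (hGd : ∀ z, DependsOn (G z) {c | 2 * (i : ℕ) < c.depth})
    (hint : Integrable (fun w => G (sineHidden (fun c => η c w) i.castSucc) fun c => η c w) P) :
    ∫ w, G (sineHidden (fun c => η c w) i.castSucc) (fun c => η c w) ∂P =
      ∫ w, ∫ w', G (sineHidden (fun c => η c w) i.castSucc) (fun c => η c w') ∂P ∂P :=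
  integral_of_dependsOn hη.indep hη.measurable (measurable_sineHidden _) hG
    (dependsOn_sineHidden _) hGd (by
      rw [Set.disjoint_left]
      intro c hc hc'
      simp only [Set.mem_ofPred_eq, Fin.val_castSucc] at hc hc'
      omega) hint

/-- Moments of a preactivation or of a product, by resampling. -/
theorem integral_linearLayer_resample [IsProbabilityMeasure P] (i : Fin N) (j : Fin d) (n : ℕ) :
    ∫ w, linearLayer (fun c => η c w) i (sineHidden (fun c => η c w) i.castSucc) j ^ n ∂P =
      ∫ w, ∫ w', linearLayer (fun c => η c w') i
        (sineHidden (fun c => η c w) i.castSucc) j ^ n ∂P ∂P := by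
  refine hη.integral_resample i (G := fun z x => linearLayer x i z j ^ n)
    ((measurable_linearLayer_uncurry i j).pow_const n).stronglyMeasurable (fun z x y h => ?_)
    (memLp_top_pow (hη.memLp_linearLayer (hη.memLp_sineHidden _) i j) n).integrable_of_top
  exact congrArg (· ^ n) (dependsOn_linearLayer_resample i z j h)

theorem integral_sineHidden_succ_resample [IsProbabilityMeasure P] (i : Fin N) (j : Fin d)
    (n : ℕ) :
    ∫ w, sineHidden (fun c => η c w) i.succ j ^ n ∂P =
      ∫ w, ∫ w', (η (.phase i.succ j) w' * linearLayer (fun c => η c w') i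
        (sineHidden (fun c => η c w) i.castSucc) j) ^ n ∂P ∂P := by
  simp only [sineHidden_succ]
  refine hη.integral_resample i (G := fun z x => (x (.phase i.succ j) * linearLayer x i z j) ^ n)
    ((measurable_product_uncurry i j).pow_const n).stronglyMeasurable (fun z x y h => ?_)
    (memLp_top_pow (hη.memLp_product (hη.memLp_sineHidden _) i j) n).integrable_of_top
  exact congrArg (· ^ n) (dependsOn_product_resample i z j h)

theorem memLp_meanPow_sineHidden [IsFiniteMeasure P] (i : Fin (N + 1)) (p : ℕ) :
    MemLp (fun w => meanPow p (sineHidden (fun c => η c w) i)) ⊤ P :=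
  memLp_meanPow (hη.memLp_sineHidden i) p

/-- The mean squared deviation of the mean square of a hidden state from one half. -/
theorem integral_meanPow_sq_le [IsProbabilityMeasure P] (i : Fin (N + 1)) :
    ∫ w, meanPow 2 (sineHidden (fun c => η c w) i) ^ 2 ∂P ≤
      2 * ∫ w, (meanPow 2 (sineHidden (fun c => η c w) i) - 1 / 2) ^ 2 ∂P + 1 / 2 := by
  have hQ := hη.memLp_meanPow_sineHidden i 2
  have i1 : Integrable (fun w => (meanPow 2 (sineHidden (fun c => η c w) i) - 1 / 2) ^ 2) P :=
    (memLp_top_pow (hQ.sub (memLp_const _)) 2).integrable_of_top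
  have h := integral_mono (memLp_top_pow hQ 2).integrable_of_top
    ((i1.const_mul 2).fun_add (integrable_const (1 / 2 : ℝ))) fun w => by
      simp only
      -- The two sides differ by exactly $(Q-1)^2$.
      nlinarith [sq_nonneg (meanPow 2 (sineHidden (fun c => η c w) i) - 1)]
  rw [integral_add (i1.const_mul 2) (integrable_const _), integral_const_mul] at h
  simpa using h

/-- An average of $d$ independent squared sines has mean $1/2$ and variance at most $1/d$. -/
theorem integral_sub_half_sq_zero_le [IsProbabilityMeasure P] (hd : 0 < d) :
    ∫ w, (meanPow 2 (sineHidden (fun c => η c w) 0) - 1 / 2) ^ 2 ∂P ≤ 1 / (d : ℝ) := by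
  have hd' : (0 : ℝ) < d := by exact_mod_cast hd
  let Y : Fin d → Ω → ℝ := fun j w => η (.phase 0 j) w ^ 2
  have hY (j) : MemLp (Y j) ⊤ P := memLp_top_pow (hη.memLp_phase 0 j) 2
  let M : Ω → ℝ := fun w => ∑ j, Y j w
  have hM : MemLp M ⊤ P := memLp_finsetSum _ fun j _ => hY j
  have hvar : Var[M; P] ≤ d := by
    have h := IndepFun.variance_sum (μ := P) (X := Y) (s := Finset.univ)
      (fun j _ => (hY j).mono_exponent le_top) (fun j _ j' _ h =>
        (hη.indep.indepFun (i := .phase 0 j) (j := .phase 0 j') (by simpa using h)).comp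
          (measurable_id.pow_const 2) (measurable_id.pow_const 2))
    have e : M = ∑ j, Y j := by
      ext w
      simp [M]
    rw [e, h]
    refine (Finset.sum_le_card_nsmul _ _ 1 fun j _ => ?_).trans_eq (by simp)
    refine (variance_le_expectation_sq (hY j).1).trans ?_
    have h1 := norm_integral_le_of_norm_le_const (μ := P) (C := 1) (f := Y j ^ 2) (by
      filter_upwards [hη.phase_le 0 j] with w hw
      simp only [Y, Pi.pow_apply, norm_pow, Real.norm_eq_abs]
      exact pow_le_one₀ (by positivity) (pow_le_one₀ (abs_nonneg _) hw))
    exact (le_abs_self _).trans (by simpa using h1)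
  have hmean : ∫ w, M w ∂P = d * (1 / 2) := by
    simp only [M]
    rw [integral_finsetSum _ fun j _ => (hY j).integrable_of_top]
    simp [Y, hη.phase_sq]
  have e : ∫ w, (meanPow 2 (sineHidden (fun c => η c w) 0) - 1 / 2) ^ 2 ∂P =
      (1 / (d : ℝ)) ^ 2 * Var[M; P] := by
    rw [variance_eq_integral hM.1.aemeasurable, hmean, ← integral_const_mul]
    refine integral_congr_ae (ae_of_all _ fun w => ?_)
    simp only [sineHidden_zero, meanPow, M, Y]
    field_simp
  rw [e]
  calc (1 / (d : ℝ)) ^ 2 * Var[M; P] ≤ (1 / (d : ℝ)) ^ 2 * d := by gcongr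
    _ = 1 / (d : ℝ) := by field_simp

/-- From $Q'-\tfrac12=(Q-\tfrac12)+(Q'-Q)$ and $(a+b)^2\le 2a^2+2b^2$. The one-step error involves
$\mathbb E Q^2\le 2e+\tfrac12$, so the recursion closes in $e$, $d$ and $\beta$. -/
theorem integral_sub_half_sq_succ_le [IsProbabilityMeasure P] (hd : 0 < d) (i : Fin N) {e : ℝ}
    (he : ∫ w, (meanPow 2 (sineHidden (fun c => η c w) i.castSucc) - 1 / 2) ^ 2 ∂P ≤ e) :
    ∫ w, (meanPow 2 (sineHidden (fun c => η c w) i.succ) - 1 / 2) ^ 2 ∂P ≤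
      2 * e + 2 * (8 / d * (12 * (2 * e + 1 / 2) + β ^ 4) + β ^ 4 / 4) := by
  have hQ := hη.memLp_meanPow_sineHidden i.castSucc 2
  have hQ' := hη.memLp_meanPow_sineHidden i.succ 2
  have i1 : Integrable (fun w =>
      (meanPow 2 (sineHidden (fun c => η c w) i.castSucc) - 1 / 2) ^ 2) P :=
    (memLp_top_pow (hQ.sub (memLp_const _)) 2).integrable_of_top
  have i1' : Integrable (fun w =>
      (meanPow 2 (sineHidden (fun c => η c w) i.succ) - 1 / 2) ^ 2) P :=
    (memLp_top_pow (hQ'.sub (memLp_const _)) 2).integrable_of_top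
  have i2 : Integrable (fun w => (meanPow 2 (sineHidden (fun c => η c w) i.succ) -
      meanPow 2 (sineHidden (fun c => η c w) i.castSucc)) ^ 2) P :=
    (memLp_top_pow (hQ'.sub hQ) 2).integrable_of_top
  have hstep : ∫ w, (meanPow 2 (sineHidden (fun c => η c w) i.succ) -
      meanPow 2 (sineHidden (fun c => η c w) i.castSucc)) ^ 2 ∂P ≤
      8 / d * (12 * (2 * e + 1 / 2) + β ^ 4) + β ^ 4 / 4 := by
    have hres := hη.integral_resample i (G := fun z x =>
        (meanPow 2 (fun j => x (.phase i.succ j) * linearLayer x i z j) - meanPow 2 z) ^ 2)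
      ((((measurable_meanPow 2).comp (measurable_pi_lambda _ fun j =>
        measurable_product_uncurry i j)).sub
        ((measurable_meanPow 2).comp measurable_fst)).pow_const 2).stronglyMeasurable
      (fun z x y h => by
        have h1 : (fun j => x (.phase i.succ j) * linearLayer x i z j) =
            fun j => y (.phase i.succ j) * linearLayer y i z j :=
          funext fun j => dependsOn_product_resample i z j h
        simp only [h1])
      (by simpa only [sineHidden_succ] using i2)
    simp only [sineHidden_succ]
    rw [hres]
    have i3 : Integrable (fun w => 8 / (d : ℝ) *
        (12 * meanPow 2 (sineHidden (fun c => η c w) i.castSucc) ^ 2 + β ^ 4) + β ^ 4 / 4) P :=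
      ((((memLp_top_pow hQ 2).integrable_of_top.const_mul 12).add
        (integrable_const _)).const_mul _).add (integrable_const _)
    refine (integral_mono_of_nonneg (ae_of_all _ fun w => integral_nonneg fun _ => sq_nonneg _) i3
      (ae_of_all _ fun w => hη.integral_meanPow_product_sub_sq_le hd i _)).trans ?_
    have i4 := (memLp_top_pow hQ 2).integrable_of_top.const_mul 12
    rw [integral_add ((i4.fun_add (integrable_const _)).const_mul _) (integrable_const _),
      integral_const_mul, integral_add i4 (integrable_const _), integral_const_mul]
    simp only [integral_const, probReal_univ, one_smul]
    have := hη.integral_meanPow_sq_le i.castSucc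
    gcongr
    linarith
  have h := integral_mono i1' ((i1.const_mul 2).fun_add (i2.const_mul 2)) fun w => by
    simp only
    nlinarith [sq_nonneg ((meanPow 2 (sineHidden (fun c => η c w) i.castSucc) - 1 / 2) -
      (meanPow 2 (sineHidden (fun c => η c w) i.succ) -
        meanPow 2 (sineHidden (fun c => η c w) i.castSucc)))]
  rw [integral_add (i1.const_mul 2) (i2.const_mul 2), integral_const_mul, integral_const_mul] at h
  linarith

theorem integral_meanPow_four_zero_le [IsProbabilityMeasure P] :
    ∫ w, meanPow 4 (sineHidden (fun c => η c w) 0) ∂P ≤ 1 := by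
  have h := norm_integral_le_of_norm_le_const (μ := P) (C := 1)
    (f := fun w => meanPow 4 (sineHidden (fun c => η c w) 0)) (by
      filter_upwards [ae_all_iff.2 fun j => hη.phase_le 0 j] with w hw
      have h4 (j) : |η (.phase 0 j) w ^ 4| ≤ 1 := by
        rw [abs_pow]
        exact pow_le_one₀ (abs_nonneg _) (hw j)
      rw [meanPow, norm_div, Real.norm_natCast]
      refine div_le_one_of_le₀ ?_ d.cast_nonneg
      refine (Finset.abs_sum_le_sum_abs _ _).trans ?_
      exact (Finset.sum_le_card_nsmul _ _ 1 fun j _ => h4 j).trans_eq (by simp))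
  exact (le_abs_self _).trans (by simpa using h)

/-- Used only for boundedness: in the characteristic function estimate this moment is divided by
$d$. -/
theorem integral_meanPow_four_succ_le [IsProbabilityMeasure P] (hd : 0 < d) (i : Fin N) {e : ℝ}
    (he : ∫ w, (meanPow 2 (sineHidden (fun c => η c w) i.castSucc) - 1 / 2) ^ 2 ∂P ≤ e) :
    ∫ w, meanPow 4 (sineHidden (fun c => η c w) i.succ) ∂P ≤
      8 * (12 * (2 * e + 1 / 2) + β ^ 4) := by
  have hd' : (0 : ℝ) < d := by exact_mod_cast hd
  have hQ := hη.memLp_meanPow_sineHidden i.castSucc 2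
  have h1 (j : Fin d) : ∫ w, sineHidden (fun c => η c w) i.succ j ^ 4 ∂P ≤
      8 * (12 * (2 * e + 1 / 2) + β ^ 4) := by
    rw [hη.integral_sineHidden_succ_resample]
    have i4 := (memLp_top_pow hQ 2).integrable_of_top.const_mul 12
    refine (integral_mono_of_nonneg (ae_of_all _ fun w => integral_nonneg fun _ => by positivity)
      ((i4.fun_add (integrable_const (β ^ 4))).const_mul 8)
      (ae_of_all _ fun w => hη.integral_product_pow_four_le i _ j)).trans ?_
    rw [integral_const_mul, integral_add i4 (integrable_const _), integral_const_mul]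
    simp only [integral_const, probReal_univ, one_smul]
    have := hη.integral_meanPow_sq_le i.castSucc
    linarith
  simp only [meanPow]
  rw [integral_div, integral_finsetSum _ fun j _ =>
    (memLp_top_pow (hη.memLp_sineHidden i.succ j) 4).integrable_of_top, div_le_iff₀ hd']
  refine (Finset.sum_le_card_nsmul _ _ _ fun j _ => h1 j).trans_eq ?_
  simp
  ring

theorem integral_abs_sub_half_le [IsProbabilityMeasure P] (i : Fin (N + 1)) :
    ∫ w, |meanPow 2 (sineHidden (fun c => η c w) i) - 1 / 2| ∂P ≤
      √(∫ w, (meanPow 2 (sineHidden (fun c => η c w) i) - 1 / 2) ^ 2 ∂P) :=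
  integral_abs_le_sqrt (((hη.memLp_meanPow_sineHidden i 2).sub
    (memLp_const (1 / 2))).mono_exponent le_top)

theorem abs_integral_meanPow_sub_half_le [IsProbabilityMeasure P] (i : Fin (N + 1)) :
    |∫ w, meanPow 2 (sineHidden (fun c => η c w) i) ∂P - 1 / 2| ≤
      √(∫ w, (meanPow 2 (sineHidden (fun c => η c w) i) - 1 / 2) ^ 2 ∂P) := by
  refine le_trans ?_ (hη.integral_abs_sub_half_le i)
  have h : ∫ w, meanPow 2 (sineHidden (fun c => η c w) i) ∂P - 1 / 2 =
      ∫ w, (meanPow 2 (sineHidden (fun c => η c w) i) - 1 / 2) ∂P := by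
    rw [integral_sub (hη.memLp_meanPow_sineHidden i 2).integrable_of_top (integrable_const _)]
    simp
  rw [h]
  exact abs_integral_le_integral_abs

theorem integral_activation [IsProbabilityMeasure P] (i : Fin N) (j : Fin d) :
    ∫ w, linearLayer (fun c => η c w) i (sineHidden (fun c => η c w) i.castSucc) j ∂P =
      ∫ w, η (.bias i j) w ∂P := by
  have h := hη.integral_linearLayer_resample i j 1
  simpa only [pow_one, hη.integral_linearLayer, integral_const, probReal_univ, one_smul] using h

theorem integral_activation_sq [IsProbabilityMeasure P] (i : Fin N) (j : Fin d) :
    ∫ w, linearLayer (fun c => η c w) i (sineHidden (fun c => η c w) i.castSucc) j ^ 2 ∂P =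
      2 * ∫ w, meanPow 2 (sineHidden (fun c => η c w) i.castSucc) ∂P +
        ∫ w, η (.bias i j) w ^ 2 ∂P := by
  rw [hη.integral_linearLayer_resample i j 2]
  simp only [hη.integral_linearLayer_sq]
  rw [integral_add ((hη.memLp_meanPow_sineHidden _ 2).integrable_of_top.const_mul 2)
    (integrable_const _), integral_const_mul]
  simp

theorem integral_sineHidden_succ [IsProbabilityMeasure P] (i : Fin N) (j : Fin d) :
    ∫ w, sineHidden (fun c => η c w) i.succ j ∂P = 0 := by
  have h := hη.integral_sineHidden_succ_resample i j 1
  simpa only [pow_one, hη.integral_product, integral_zero] using h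

theorem integral_sineHidden_succ_sq [IsProbabilityMeasure P] (i : Fin N) (j : Fin d) :
    ∫ w, sineHidden (fun c => η c w) i.succ j ^ 2 ∂P =
      ∫ w, meanPow 2 (sineHidden (fun c => η c w) i.castSucc) ∂P +
        (∫ w, η (.bias i j) w ^ 2 ∂P) / 2 := by
  rw [hη.integral_sineHidden_succ_resample i j 2]
  simp only [hη.integral_product_sq]
  rw [integral_add (hη.memLp_meanPow_sineHidden _ 2).integrable_of_top (integrable_const _)]
  simp

/-- The intermediate term is the conditional Gaussian $e^{-t^2Q}$. Replacing $Q$ by $1/2$ costs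
$t^2\,\mathbb E|Q-\tfrac12|$, because $u\mapsto e^{-u}$ is $1$-Lipschitz on $[0,\infty)$. -/
theorem norm_charFun_activation_sub_le [IsProbabilityMeasure P] (i : Fin N) (j : Fin d) (t : ℝ) :
    ‖∫ w, Complex.exp ((t * linearLayer (fun c => η c w) i
        (sineHidden (fun c => η c w) i.castSucc) j : ℝ) * Complex.I) ∂P -
      (Real.exp (-(t ^ 2 / 2)) : ℝ)‖ ≤
      37 * t ^ 4 / d * ∫ w, meanPow 4 (sineHidden (fun c => η c w) i.castSucc) ∂P + |t| * β +
      t ^ 2 * √(∫ w, (meanPow 2 (sineHidden (fun c => η c w) i.castSucc) - 1 / 2) ^ 2 ∂P) := by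
  have hmeas : Measurable fun p : (Fin d → ℝ) × (Coord N din d → ℝ) =>
      Complex.exp ((t * linearLayer p.2 i p.1 j : ℝ) * Complex.I) :=
    Complex.measurable_exp.comp ((Complex.measurable_ofReal.comp
      ((measurable_linearLayer_uncurry i j).const_mul t)).mul_const _)
  have hηm : Measurable fun w => (fun c => η c w) := measurable_pi_lambda _ hη.measurable
  have hZm : Measurable fun w => sineHidden (fun c => η c w) i.castSucc :=
    (measurable_sineHidden _).comp hηm
  have hres := hη.integral_resample i (G := fun z x =>
      Complex.exp ((t * linearLayer x i z j : ℝ) * Complex.I))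
    hmeas.stronglyMeasurable
    (fun z x y h => by
      have h1 : linearLayer x i z j = linearLayer y i z j := by
        exact dependsOn_linearLayer_resample i z j h
      simp only [h1])
    (Integrable.of_bound (C := 1) (hmeas.comp (hZm.prodMk hηm)).aestronglyMeasurable
      (ae_of_all _ fun w => by rw [Complex.norm_exp_ofReal_mul_I]))
  have hinner : Integrable (fun w => ∫ w', Complex.exp ((t * linearLayer (fun c => η c w') i
      (sineHidden (fun c => η c w) i.castSucc) j : ℝ) * Complex.I) ∂P) P := by
    refine Integrable.of_bound (C := 1) ?_ (ae_of_all _ fun w => ?_)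
    · have h : StronglyMeasurable fun p : Ω × Ω => Complex.exp ((t * linearLayer
          (fun c => η c p.2) i (sineHidden (fun c => η c p.1) i.castSucc) j : ℝ) * Complex.I) :=
        (hmeas.comp ((hZm.comp measurable_fst).prodMk (hηm.comp measurable_snd))).stronglyMeasurable
      exact (h.integral_prod_right (ν := P)).aestronglyMeasurable
    · refine (norm_integral_le_of_norm_le_const (C := 1) (ae_of_all _ fun w' => ?_)).trans_eq
        (by simp)
      rw [Complex.norm_exp_ofReal_mul_I]
  have hconst : ((Real.exp (-(t ^ 2 / 2)) : ℝ) : ℂ) =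
      ∫ _, ((Real.exp (-(t ^ 2 / 2)) : ℝ) : ℂ) ∂P := by simp
  rw [hres, hconst, ← integral_sub hinner (integrable_const _)]
  have i1 := ((hη.memLp_meanPow_sineHidden i.castSucc 4).integrable_of_top.const_mul
    (37 * t ^ 4 / (d : ℝ)))
  have i2 : Integrable (fun w =>
      |meanPow 2 (sineHidden (fun c => η c w) i.castSucc) - 1 / 2|) P :=
    ((hη.memLp_meanPow_sineHidden i.castSucc 2).integrable_of_top.sub (integrable_const _)).abs
  refine (norm_integral_le_of_norm_le
    ((i1.fun_add (integrable_const (|t| * β))).fun_add (i2.const_mul (t ^ 2)))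
    (ae_of_all _ fun w => ?_)).trans ?_
  · refine (norm_sub_le_norm_sub_add_norm_sub _ ((Real.exp (-(t ^ 2 *
      meanPow 2 (sineHidden (fun c => η c w) i.castSucc))) : ℝ) : ℂ) _).trans
      (add_le_add (hη.norm_integral_exp_linearLayer_sub_le i _ j t) ?_)
    rw [← Complex.ofReal_sub, Complex.norm_real]
    refine (abs_exp_neg_sub_exp_neg_le
      (mul_nonneg (sq_nonneg t) (meanPow_two_nonneg _)) (by positivity)).trans_eq ?_
    rw [← abs_of_nonneg (sq_nonneg t), ← abs_mul, abs_of_nonneg (sq_nonneg t)]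
    congr 1
    ring
  · rw [integral_add (i1.fun_add (integrable_const _)) (i2.const_mul _),
      integral_add i1 (integrable_const _), integral_const_mul, integral_const_mul]
    simp only [integral_const, probReal_univ, one_smul]
    rw [integral_const_mul]
    gcongr
    exact hη.integral_abs_sub_half_le i.castSucc

end IsSineFamily


/-! ### The infinite-width limit. -/

section Limit

variable {N din : ℕ} {d : ℕ → ℕ} {β : ℕ → ℝ} {Ω : ℕ → Type*} [∀ n, MeasurableSpace (Ω n)]
  {P : ∀ n, Measure (Ω n)} [∀ n, IsProbabilityMeasure (P n)]
  {η : ∀ n, Coord N din (d n) → Ω n → ℝ}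

theorem tendsto_natCast_width (hd : Tendsto d atTop atTop) :
    Tendsto (fun n => (d n : ℝ)) atTop atTop := tendsto_natCast_atTop_atTop.comp hd

theorem tendsto_meanPow_two_deviation (hd : Tendsto d atTop atTop) (hd0 : ∀ n, 0 < d n)
    (hβ : Tendsto β atTop (𝓝 0)) (hη : ∀ n, IsSineFamily (η n) (P n) (β n)) (i : Fin (N + 1)) :
    Tendsto (fun n => ∫ w, (meanPow 2 (sineHidden (fun c => η n c w) i) - 1 / 2) ^ 2 ∂(P n))
      atTop (𝓝 0) := by
  have hd' := tendsto_natCast_width hd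
  induction i using Fin.induction with
  | zero =>
    exact squeeze_zero (fun n => integral_nonneg fun _ => sq_nonneg _)
      (fun n => (hη n).integral_sub_half_sq_zero_le (hd0 n)) (hd'.const_div_atTop 1)
  | succ i ih =>
    refine squeeze_zero (fun n => integral_nonneg fun _ => sq_nonneg _)
      (fun n => (hη n).integral_sub_half_sq_succ_le (hd0 n) i le_rfl) ?_
    have h := (ih.const_mul 2).add ((((hd'.const_div_atTop 8).mul
      ((((ih.const_mul 2).add_const (1 / 2)).const_mul 12).add (hβ.pow 4))).add
        ((hβ.pow 4).div_const 4)).const_mul 2)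
    simpa using h

theorem tendsto_meanPow_four_div (hd : Tendsto d atTop atTop) (hd0 : ∀ n, 0 < d n)
    (hβ : Tendsto β atTop (𝓝 0)) (hη : ∀ n, IsSineFamily (η n) (P n) (β n)) (i : Fin (N + 1)) :
    Tendsto (fun n => (∫ w, meanPow 4 (sineHidden (fun c => η n c w) i) ∂(P n)) / d n)
      atTop (𝓝 0) := by
  have hd' := tendsto_natCast_width hd
  have h0 (i : Fin (N + 1)) (n : ℕ) :
      0 ≤ (∫ w, meanPow 4 (sineHidden (fun c => η n c w) i) ∂(P n)) / d n :=
    div_nonneg (integral_nonneg fun w => div_nonneg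
      (Finset.sum_nonneg fun _ _ => by positivity) (Nat.cast_nonneg _)) (Nat.cast_nonneg _)
  induction i using Fin.induction with
  | zero =>
    exact squeeze_zero (h0 0)
      (fun n => div_le_div_of_nonneg_right (hη n).integral_meanPow_four_zero_le
        (Nat.cast_nonneg _)) (hd'.const_div_atTop 1)
  | succ i _ =>
    have he := tendsto_meanPow_two_deviation hd hd0 hβ hη i.castSucc
    refine squeeze_zero (h0 i.succ)
      (fun n => div_le_div_of_nonneg_right
        ((hη n).integral_meanPow_four_succ_le (hd0 n) i le_rfl) (Nat.cast_nonneg _)) ?_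
    exact ((((((he.const_mul 2).add_const (1 / 2)).const_mul 12).add
      (hβ.pow 4)).const_mul 8)).div_atTop hd'

theorem tendsto_integral_meanPow_two (hd : Tendsto d atTop atTop) (hd0 : ∀ n, 0 < d n)
    (hβ : Tendsto β atTop (𝓝 0)) (hη : ∀ n, IsSineFamily (η n) (P n) (β n)) (i : Fin (N + 1)) :
    Tendsto (fun n => ∫ w, meanPow 2 (sineHidden (fun c => η n c w) i) ∂(P n))
      atTop (𝓝 (1 / 2)) := by
  rw [tendsto_iff_norm_sub_tendsto_zero]
  have h := (tendsto_meanPow_two_deviation hd hd0 hβ hη i).sqrt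
  rw [Real.sqrt_zero] at h
  exact squeeze_zero (fun n => norm_nonneg _)
    (fun n => (hη n).abs_integral_meanPow_sub_half_le i) h

theorem tendsto_integral_bias (hβ : Tendsto β atTop (𝓝 0))
    (hη : ∀ n, IsSineFamily (η n) (P n) (β n)) (i : Fin N) (j : ∀ n, Fin (d n)) :
    Tendsto (fun n => ∫ w, η n (.bias i (j n)) w ∂(P n)) atTop (𝓝 0) :=
  squeeze_zero_norm (fun n => (hη n).abs_integral_bias_le i (j n)) hβ

theorem tendsto_integral_bias_sq (hβ : Tendsto β atTop (𝓝 0))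
    (hη : ∀ n, IsSineFamily (η n) (P n) (β n)) (i : Fin N) (j : ∀ n, Fin (d n)) :
    Tendsto (fun n => ∫ w, η n (.bias i (j n)) w ^ 2 ∂(P n)) atTop (𝓝 0) :=
  squeeze_zero (fun n => integral_nonneg fun _ => sq_nonneg _)
    (fun n => (hη n).integral_bias_pow_le i (j n) 2) (by simpa using hβ.pow 2)

theorem tendsto_charFun_activation (hd : Tendsto d atTop atTop) (hd0 : ∀ n, 0 < d n)
    (hβ : Tendsto β atTop (𝓝 0)) (hη : ∀ n, IsSineFamily (η n) (P n) (β n)) (i : Fin N)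
    (j : ∀ n, Fin (d n)) (t : ℝ) :
    Tendsto (fun n => ∫ w, Complex.exp ((t * linearLayer (fun c => η n c w) i
        (sineHidden (fun c => η n c w) i.castSucc) (j n) : ℝ) * Complex.I) ∂(P n)) atTop
      (𝓝 (Real.exp (-(t ^ 2 / 2)) : ℝ)) := by
  rw [tendsto_iff_norm_sub_tendsto_zero]
  refine squeeze_zero (fun n => norm_nonneg _)
    (fun n => (hη n).norm_charFun_activation_sub_le i (j n) t) ?_
  have h := ((((tendsto_meanPow_four_div hd hd0 hβ hη i.castSucc).const_mul (37 * t ^ 4)).add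
    (hβ.const_mul |t|))).add
      ((tendsto_meanPow_two_deviation hd hd0 hβ hη i.castSucc).sqrt.const_mul (t ^ 2))
  simp only [mul_zero, Real.sqrt_zero, add_zero] at h
  refine h.congr fun n => ?_
  ring

/-- Lévy's continuity theorem turns the pointwise limit of characteristic functions into convergence
in distribution. -/
theorem tendstoInDistribution_activation (hd : Tendsto d atTop atTop) (hd0 : ∀ n, 0 < d n)
    (hβ : Tendsto β atTop (𝓝 0)) (hη : ∀ n, IsSineFamily (η n) (P n) (β n)) (i : Fin N)
    (j : ∀ n, Fin (d n)) :
    TendstoInDistribution (fun n w => linearLayer (fun c => η n c w) i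
        (sineHidden (fun c => η n c w) i.castSucc) (j n)) atTop
      (id : ℝ → ℝ) P (gaussianReal 0 1) := by
  have hm (n) : AEMeasurable (fun w => linearLayer (fun c => η n c w) i
      (sineHidden (fun c => η n c w) i.castSucc) (j n)) (P n) :=
    ((hη n).memLp_linearLayer ((hη n).memLp_sineHidden i.castSucc) i (j n)).1.aemeasurable
  refine ⟨hm, aemeasurable_id, ?_⟩
  refine ProbabilityMeasure.tendsto_iff_tendsto_charFun.2 fun t => ?_
  have hlim : charFun ((gaussianReal 0 1).map (id : ℝ → ℝ)) t =
      ((Real.exp (-(t ^ 2 / 2)) : ℝ) : ℂ) := by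
    rw [Measure.map_id, charFun_gaussianReal]
    push_cast
    congr 1
    simp
  simp only [ProbabilityMeasure.coe_mk]
  rw [hlim]
  refine (tendsto_charFun_activation hd hd0 hβ hη i j t).congr fun n => ?_
  rw [charFun_apply_real, integral_map (hm n) (by fun_prop)]
  push_cast
  rfl

end Limit

end Bacon

/-! ### Transfer back to the original network. -/

theorem mainTheorem3 (N din : ℕ) (d : ℕ → ℕ) (hd : Tendsto d atTop atTop)
    (B : ℕ → Fin (N + 1) → ℝ) (hB : ∀ n i, 0 < B n i)
    (β : ℕ → ℝ) (hβ : Tendsto β atTop (𝓝 0))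
    (Ω : ℕ → Type*) [∀ n, MeasurableSpace (Ω n)]
    (P : ∀ n, Measure (Ω n)) [∀ n, IsProbabilityMeasure (P n)]
    (θ : ∀ n, Bacon.Coord N din (d n) → Ω n → ℝ)
    (hθ : ∀ n, Bacon.IsInitialization (θ n) (P n) (B n) (β n))
    (j : ∀ n, Fin (d n)) :
    -- sine layers have mean zero and variance one half
    (∀ (i : Fin (N + 1)) (n : ℕ),
      ∫ w, Bacon.sineLayer (fun c => θ n c w) i (j n) ∂(P n) = 0 ∧
      Var[fun w => Bacon.sineLayer (fun c => θ n c w) i (j n); P n] = 1 / 2) ∧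
    -- activations after every linear layer are asymptotically standard normal
    (∀ i : Fin N,
      TendstoInDistribution
        (fun n w => Bacon.activation (fun c => θ n c w) i (j n)) atTop
        (id : ℝ → ℝ) P (gaussianReal 0 1) ∧
      (∀ n, MemLp (fun w => Bacon.activation (fun c => θ n c w) i (j n)) 2 (P n)) ∧
      Tendsto (fun n => ∫ w, Bacon.activation (fun c => θ n c w) i (j n) ∂(P n)) atTop (𝓝 0) ∧
      Tendsto (fun n => Var[fun w => Bacon.activation (fun c => θ n c w) i (j n); P n])
        atTop (𝓝 1)) ∧
    -- Hadamard products have mean zero and variance tending to one half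
    (∀ i : Fin N,
      (∀ n, ∫ w, Bacon.hidden (fun c => θ n c w) i.succ (j n) ∂(P n) = 0) ∧
      Tendsto (fun n => Var[fun w => Bacon.hidden (fun c => θ n c w) i.succ (j n); P n])
        atTop (𝓝 (1 / 2))) := by
  have hd0 (n) : 0 < d n := (j n).pos
  let η : ∀ n, Bacon.Coord N din (d n) → Ω n → ℝ :=
    fun n c w => Bacon.sineFamily (fun c' => θ n c' w) c
  have hη (n) : Bacon.IsSineFamily (η n) (P n) (β n) := (hθ n).isSineFamily (hd0 n)
  have hhid (n) (w) (i : Fin (N + 1)) : Bacon.hidden (fun c => θ n c w) i =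
      Bacon.sineHidden (fun c => η n c w) i := (Bacon.sineHidden_sineFamily _ i).symm
  have hact (n) (w) (i : Fin N) : Bacon.activation (fun c => θ n c w) i =
      Bacon.linearLayer (fun c => η n c w) i (Bacon.sineHidden (fun c => η n c w) i.castSucc) := by
    rw [Bacon.activation, hhid]
    rfl
  have hQ := Bacon.tendsto_integral_meanPow_two hd hd0 hβ hη
  refine ⟨fun i n => ⟨(hη n).phase_mean i (j n), ?_⟩, fun i => ?_, fun i => ?_⟩
  · change Var[η n (.phase i (j n)); P n] = 1 / 2
    rw [variance_of_integral_eq_zero ((hη n).measurable _).aemeasurable ((hη n).phase_mean i (j n))]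
    exact (hη n).phase_sq i (j n)
  · simp only [hact]
    have hL (n) := ((hη n).memLp_linearLayer ((hη n).memLp_sineHidden i.castSucc) i
      (j n)).mono_exponent (p := 2) le_top
    have h1 := Bacon.tendsto_integral_bias hβ hη i j
    have h2 := Bacon.tendsto_integral_bias_sq hβ hη i j
    refine ⟨Bacon.tendstoInDistribution_activation hd hd0 hβ hη i j, hL, ?_, ?_⟩
    · simpa only [(hη _).integral_activation] using h1
    -- Second moment minus squared mean: the limit is $2\cdot\tfrac12+0-0^2$.
    · have h := (((hQ i.castSucc).const_mul 2).add h2).sub (h1.pow 2)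
      norm_num at h
      refine h.congr fun n => ?_
      rw [variance_eq_sub (hL n), (hη n).integral_activation]
      simp only [Pi.pow_apply]
      rw [(hη n).integral_activation_sq]
  · simp only [hhid]
    refine ⟨fun n => (hη n).integral_sineHidden_succ i (j n), ?_⟩
    have h := (hQ i.castSucc).add ((Bacon.tendsto_integral_bias_sq hβ hη i j).div_const 2)
    rw [zero_div, add_zero] at h
    refine h.congr fun n => ?_
    rw [variance_of_integral_eq_zero ((hη n).memLp_sineHidden i.succ (j n)).1.aemeasurable
      ((hη n).integral_sineHidden_succ i (j n)), (hη n).integral_sineHidden_succ_sq]
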